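/- A *phase-free ZX diagram* $D : m \to n$ is built by sequential composition and tensor product from the empty diagram, identity wires, swaps, cups, caps and the phase-free Z and X spiders with any numbers $m, n \ge 0$ of inputs and outputs. It denotes a linear map $[\![D]\!] : (\mathbb C^2)^{\otimes m} \to (\mathbb C^2)^{\otimes n}$: composition is the product and parallel composition the tensor product of linear maps, and $$\text{wire} = \sum_i |i\rangle\langle i|,\quad \text{swap} = \sum_{i,j} |ij\rangle\langle ji|,\quad \text{cup} = \sum_i |ii\rangle,\quad \text{cap} = \sum_i \langle ii|,$$ $$Z_{m,n} = |0\rangle^{\otimes n}\langle 0|^{\otimes m} + |1\rangle^{\otimes n}\langle 1|^{\otimes m},\qquad X_{m,n} = |{+}\rangle^{\otimes n}\langle {+}|^{\otimes m} + |{-}\rangle^{\otimes n}\langle {-}|^{\otimes m}.$$ Diagrams are regarded as undirected multigraphs of spiders with ordered inputs and outputs, up to isomorphism. The rules of the *phase-free ZX calculus* are the following; they may be applied anywhere in a diagram and in both directions. * (sp) Two spiders of the same colour that are joined by one or more wires fuse into one spider, and these wires disappear; a spider of either colour with exactly two legs is a plain wire. * (sc) For all $p, q \ge 0$: an X spider and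 a Z spider joined by one wire, the X spider with $p$ further legs and the Z spider with $q$ further legs, equal $2^{(p-1)(q-1)/2}$ times the complete bipartite graph on $p$ Z spiders and $q$ X spiders, in which each Z spider takes over one of the $p$ legs and each X spider takes over one of the $q$ legs. **Theorem (completeness of the phase-free ZX calculus).** Let $D, D'$ be phase-free ZX diagrams with $m$ inputs and $n$ outputs. If $[\![D]\!] = [\![D']\!]$, then $D$ can be rewritten into $D'$ using only the rules (sp) and (sc), with all scalar factors taken into account. More generally, if $[\![D]\!] = c\,[\![D']\!]$ for some $c \in \mathbb C \setminus \{0\}$, then $D$ can be rewritten into $c$ times $D'$. -/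

import Mathlib

/-! # Phase-free ZX diagrams, their linear maps, and the phase-free ZX calculus -/

namespace PhaseFreeZX

noncomputable section

/-- The two colours of spiders. -/
inductive Color where
  | z : Color
  | x : Color

/-- Phase-free ZX diagrams with `m` inputs and `n` outputs: everything that can be built from
spiders, identity wires, swaps, cups and caps by sequential and parallel composition.
`comp D E` means first `D`, then `E`; `empty` is the empty diagram. -/
inductive Diagram : ℕ → ℕ → Type where
  | spider (c : Color) (m n : ℕ) : Diagram m n
  | empty : Diagram 0 0
  | wire : Diagram 1 1
  | swap : Diagram 2 2
  | cup : Diagram 0 2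
  | cap : Diagram 2 0
  | comp {m k n : ℕ} (D : Diagram m k) (E : Diagram k n) : Diagram m n
  | tensor {m n m' n' : ℕ} (D : Diagram m n) (E : Diagram m' n') : Diagram (m + m') (n + n')

/-! ## The linear map of a diagram -/

/-- Linear maps from `m` qubits to `n` qubits, as matrices in the computational basis. -/
abbrev QMap (m n : ℕ) : Type := Matrix (Fin n → Fin 2) (Fin m → Fin 2) ℂ

/-- The one-qubit vectors `|0⟩`, `|1⟩`, `|+⟩`, `|-⟩`: the vectors `ket c 0` and `ket c 1` form the
eigenbasis of Pauli Z (for `c = z`) or Pauli X (for `c = x`). -/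
def ket : Color → Fin 2 → (Fin 2 → ℂ)
  | .z, 0 => ![1, 0]
  | .z, 1 => ![0, 1]
  | .x, 0 => ![1 / (Real.sqrt 2 : ℂ), 1 / (Real.sqrt 2 : ℂ)]
  | .x, 1 => ![1 / (Real.sqrt 2 : ℂ), -1 / (Real.sqrt 2 : ℂ)]

/-- `|a₀⟩^{⊗ n} ⟨a₀|^{⊗ m} + |a₁⟩^{⊗ n} ⟨a₁|^{⊗ m}` for the basis `a₀, a₁` of colour `c`. -/
def spiderMap (c : Color) (m n : ℕ) : QMap m n := fun y x =>
  ∑ i : Fin 2, (∏ j, ket c i (y j)) * ∏ j, star (ket c i (x j))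

/-- The linear map of a diagram: composition is the product of matrices, parallel composition the
tensor (Kronecker) product. -/
def Diagram.denote : {m n : ℕ} → Diagram m n → QMap m n
  | _, _, .spider c m n => spiderMap c m n
  | _, _, .empty => 1
  | _, _, .wire => 1
  | _, _, .swap => fun y x => if y 0 = x 1 ∧ y 1 = x 0 then 1 else 0
  | _, _, .cup => fun y _ => if y 0 = y 1 then 1 else 0
  | _, _, .cap => fun _ x => if x 0 = x 1 then 1 else 0
  | _, _, .comp D E => E.denote * D.denote
  | _, _, .tensor (m := m) (n := n) (m' := m') (n' := n') D E => fun y x =>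
      D.denote (fun j => y (Fin.castAdd n' j)) (fun i => x (Fin.castAdd m' i)) *
        E.denote (fun j => y (Fin.natAdd n j)) (fun i => x (Fin.natAdd m i))

/-! ## The labelled undirected graph of a diagram -/

/-- A vertex of the graph is a spider, or a point on a wire. -/
inductive Kind where
  | spider (c : Color) : Kind
  | wire : Kind

/-- The ends of the diagram: its ordered inputs (left) and its ordered outputs (right). -/
abbrev Bdry (m n : ℕ) : Type := Fin m ⊕ Fin n

/-- Finite undirected multigraphs (loops and parallel edges allowed) whose vertices are spiders,
points on wires, and the `m` inputs and `n` outputs. The graphs of diagrams, and all graphs obtained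
from them by `Derives` below, have degree one at inputs and outputs and degree two at points on
wires. A loop of bare wire is a point on a wire with one edge to itself. -/
structure Graph (m n : ℕ) where
  V : Type
  E : Type
  kind : V → Kind
  ends : E → Sym2 (V ⊕ Bdry m n)
  [finV : Finite V]
  [finE : Finite E]

/-- Isomorphisms of graphs that fix the inputs and the outputs. -/
structure Graph.Iso {m n : ℕ} (G H : Graph m n) where
  onV : G.V ≃ H.V
  onE : G.E ≃ H.E
  kind_eq : ∀ v, H.kind (onV v) = G.kind v
  ends_eq : ∀ e, H.ends (onE e) = Sym2.map (Sum.map onV id) (G.ends e)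

/-- The graph of a composite: the `i`-th output of `G` and the `i`-th input of `H` become one point
on a wire. -/
def Graph.comp {m k n : ℕ} (G : Graph m k) (H : Graph k n) : Graph m n :=
  haveI := G.finV; haveI := G.finE; haveI := H.finV; haveI := H.finE
  { V := (G.V ⊕ H.V) ⊕ Fin k
    E := G.E ⊕ H.E
    kind := Sum.elim (Sum.elim G.kind H.kind) (fun _ => Kind.wire)
    ends := Sum.elim
      (fun e => Sym2.map (Sum.elim (fun v => Sum.inl (Sum.inl (Sum.inl v)))
        (Sum.elim (fun i => Sum.inr (Sum.inl i)) (fun j => Sum.inl (Sum.inr j)))) (G.ends e))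
      (fun e => Sym2.map (Sum.elim (fun v => Sum.inl (Sum.inl (Sum.inr v)))
        (Sum.elim (fun j => Sum.inl (Sum.inr j)) (fun i => Sum.inr (Sum.inr i)))) (H.ends e)) }

/-- Disjoint union of graphs; the ends of `G` come before those of `H`. -/
def Graph.tensor {m n m' n' : ℕ} (G : Graph m n) (H : Graph m' n') :
    Graph (m + m') (n + n') :=
  haveI := G.finV; haveI := G.finE; haveI := H.finV; haveI := H.finE
  { V := G.V ⊕ H.V
    E := G.E ⊕ H.E
    kind := Sum.elim G.kind H.kind
    ends := Sum.elim
      (fun e => Sym2.map (Sum.map Sum.inl (Sum.map (Fin.castAdd m') (Fin.castAdd n'))) (G.ends e))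
      (fun e => Sym2.map (Sum.map Sum.inr (Sum.map (Fin.natAdd m) (Fin.natAdd n))) (H.ends e)) }

/-- The graph of a diagram. -/
def Diagram.graph : {m n : ℕ} → Diagram m n → Graph m n
  | _, _, .spider c m n =>
      { V := Unit
        E := Bdry m n
        kind := fun _ => Kind.spider c
        ends := fun e => s(Sum.inl (), Sum.inr e) }
  | _, _, .empty => { V := Empty, E := Empty, kind := Empty.elim, ends := Empty.elim }
  | _, _, .wire =>
      { V := Empty, E := Unit, kind := Empty.elim
        ends := fun _ => s(Sum.inr (Sum.inl 0), Sum.inr (Sum.inr 0)) }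
  | _, _, .swap =>
      { V := Empty, E := Fin 2, kind := Empty.elim
        ends := ![s(Sum.inr (Sum.inl 0), Sum.inr (Sum.inr 1)),
          s(Sum.inr (Sum.inl 1), Sum.inr (Sum.inr 0))] }
  | _, _, .cup =>
      { V := Empty, E := Unit, kind := Empty.elim
        ends := fun _ => s(Sum.inr (Sum.inr 0), Sum.inr (Sum.inr 1)) }
  | _, _, .cap =>
      { V := Empty, E := Unit, kind := Empty.elim
        ends := fun _ => s(Sum.inr (Sum.inl 0), Sum.inr (Sum.inl 1)) }
  | _, _, .comp D E => D.graph.comp E.graph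
  | _, _, .tensor D E => D.graph.tensor E.graph

/-! ## The calculus -/

section Rules

variable {m n : ℕ} {V₀ E₀ : Type} [Finite V₀] [Finite E₀]

/-- Two adjacent spiders of colour `c`, with `p + 1` distinguished edges between them, inside an
arbitrary graph. The edges in `E₀` are arbitrary. -/
def fuseLHS (c : Color) (p : ℕ) (kind₀ : V₀ → Kind)
    (ends₀ : E₀ → Sym2 ((V₀ ⊕ Fin 2) ⊕ Bdry m n)) : Graph m n where
  V := V₀ ⊕ Fin 2
  E := E₀ ⊕ Fin (p + 1)
  kind := Sum.elim kind₀ (fun _ => Kind.spider c)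
  ends := Sum.elim ends₀ (fun _ => s(Sum.inl (Sum.inr 0), Sum.inl (Sum.inr 1)))

/-- The two spiders merged into one, with the distinguished edges removed. -/
def fuseRHS (c : Color) (kind₀ : V₀ → Kind)
    (ends₀ : E₀ → Sym2 ((V₀ ⊕ Fin 2) ⊕ Bdry m n)) : Graph m n where
  V := V₀ ⊕ Unit
  E := E₀
  kind := Sum.elim kind₀ (fun _ => Kind.spider c)
  ends := fun e => Sym2.map (Sum.map (Sum.map id (fun _ => ())) id) (ends₀ e)

/-- A vertex of degree two on a wire between `a` and `b`. -/
def midVertex (k : Kind) (kind₀ : V₀ → Kind) (ends₀ : E₀ → Sym2 (V₀ ⊕ Bdry m n))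
    (a b : V₀ ⊕ Bdry m n) : Graph m n where
  V := V₀ ⊕ Unit
  E := E₀ ⊕ Fin 2
  kind := Sum.elim kind₀ (fun _ => k)
  ends := Sum.elim (fun e => Sym2.map (Sum.map Sum.inl id) (ends₀ e))
    ![s(Sum.map Sum.inl id a, Sum.inl (Sum.inr ())),
      s(Sum.inl (Sum.inr ()), Sum.map Sum.inl id b)]

/-- A plain wire between `a` and `b`. -/
def plainWire (kind₀ : V₀ → Kind) (ends₀ : E₀ → Sym2 (V₀ ⊕ Bdry m n))
    (a b : V₀ ⊕ Bdry m n) : Graph m n where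
  V := V₀
  E := E₀ ⊕ Unit
  kind := kind₀
  ends := Sum.elim ends₀ (fun _ => s(a, b))

/-- An X spider joined by one wire to a Z spider. The other `p` legs of the X spider go to the
vertices `a i`, the other `q` legs of the Z spider to the vertices `b j`. -/
def scLHS (p q : ℕ) (kind₀ : V₀ → Kind) (ends₀ : E₀ → Sym2 (V₀ ⊕ Bdry m n))
    (a : Fin p → V₀ ⊕ Bdry m n) (b : Fin q → V₀ ⊕ Bdry m n) : Graph m n where
  V := V₀ ⊕ Fin 2
  E := (E₀ ⊕ Unit) ⊕ (Fin p ⊕ Fin q)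
  kind := Sum.elim kind₀ ![Kind.spider Color.x, Kind.spider Color.z]
  ends := Sum.elim
    (Sum.elim (fun e => Sym2.map (Sum.map Sum.inl id) (ends₀ e))
      (fun _ => s(Sum.inl (Sum.inr 0), Sum.inl (Sum.inr 1))))
    (Sum.elim (fun i => s(Sum.map Sum.inl id (a i), Sum.inl (Sum.inr 0)))
      (fun j => s(Sum.inl (Sum.inr 1), Sum.map Sum.inl id (b j))))

/-- `p` Z spiders, the `i`-th with a leg to `a i`, and `q` X spiders, the `j`-th with a leg to
`b j`, joined by a complete bipartite graph. -/
def scRHS (p q : ℕ) (kind₀ : V₀ → Kind) (ends₀ : E₀ → Sym2 (V₀ ⊕ Bdry m n))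
    (a : Fin p → V₀ ⊕ Bdry m n) (b : Fin q → V₀ ⊕ Bdry m n) : Graph m n where
  V := V₀ ⊕ (Fin p ⊕ Fin q)
  E := (E₀ ⊕ Fin p × Fin q) ⊕ (Fin p ⊕ Fin q)
  kind := Sum.elim kind₀
    (Sum.elim (fun _ => Kind.spider Color.z) (fun _ => Kind.spider Color.x))
  ends := Sum.elim
    (Sum.elim (fun e => Sym2.map (Sum.map Sum.inl id) (ends₀ e))
      (fun ij => s(Sum.inl (Sum.inr (Sum.inl ij.1)), Sum.inl (Sum.inr (Sum.inr ij.2)))))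
    (Sum.elim (fun i => s(Sum.map Sum.inl id (a i), Sum.inl (Sum.inr (Sum.inl i))))
      (fun j => s(Sum.inl (Sum.inr (Sum.inr j)), Sum.map Sum.inl id (b j))))

end Rules

/-- `Derives c G H`: the graph `G` can be rewritten into `c` times the graph `H`. Rules can be
applied anywhere in a graph, in both directions. The constructors `iso` and `point` say that
diagrams are considered as undirected graphs, and that points on a wire carry no meaning; `fuse` and
`ident` are the spider rules; `sc` is strong complementarity, with its factor
`2 ^ ((p - 1) * (q - 1) / 2)`. -/
inductive Derives {m n : ℕ} : ℂ → Graph m n → Graph m n → Prop where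
  | symm {c : ℂ} {G H : Graph m n} : Derives c G H → Derives c⁻¹ H G
  | trans {c d : ℂ} {G H K : Graph m n} : Derives c G H → Derives d H K → Derives (c * d) G K
  | iso {G H : Graph m n} (f : G.Iso H) : Derives 1 G H
  | point {V₀ E₀ : Type} [Finite V₀] [Finite E₀] (kind₀ : V₀ → Kind)
      (ends₀ : E₀ → Sym2 (V₀ ⊕ Bdry m n)) (a b : V₀ ⊕ Bdry m n) :
      Derives 1 (midVertex Kind.wire kind₀ ends₀ a b) (plainWire kind₀ ends₀ a b)
  | ident {V₀ E₀ : Type} [Finite V₀] [Finite E₀] (c : Color) (kind₀ : V₀ → Kind)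
      (ends₀ : E₀ → Sym2 (V₀ ⊕ Bdry m n)) (a b : V₀ ⊕ Bdry m n) :
      Derives 1 (midVertex (Kind.spider c) kind₀ ends₀ a b) (plainWire kind₀ ends₀ a b)
  | fuse {V₀ E₀ : Type} [Finite V₀] [Finite E₀] (c : Color) (p : ℕ) (kind₀ : V₀ → Kind)
      (ends₀ : E₀ → Sym2 ((V₀ ⊕ Fin 2) ⊕ Bdry m n)) :
      Derives 1 (fuseLHS c p kind₀ ends₀) (fuseRHS c kind₀ ends₀)
  | sc {V₀ E₀ : Type} [Finite V₀] [Finite E₀] (p q : ℕ) (kind₀ : V₀ → Kind)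
      (ends₀ : E₀ → Sym2 (V₀ ⊕ Bdry m n)) (a : Fin p → V₀ ⊕ Bdry m n)
      (b : Fin q → V₀ ⊕ Bdry m n) :
      Derives ((Real.sqrt 2 : ℂ) ^ (((p : ℤ) - 1) * ((q : ℤ) - 1)))
        (scLHS p q kind₀ ends₀ a b) (scRHS p q kind₀ ends₀ a b)

end

end PhaseFreeZX

namespace PhaseFreeZX

noncomputable section

/-! ## Rewriting up to scalars -/

/-! Every diagram is brought to a normal form that amounts to a generating family of a linear code
over 𝔽₂. The normal form `bipM M id` has one X spider at each input and output, Z spiders indexed by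
`A`, and `M a b` edges between Z spider `a` and X spider `b`. Summing over the indices of the X
spiders forces the boundary bits `β` to equal `∑ a, z a * M a` modulo 2, where `z` are the indices
of the Z spiders. The value at `β` is therefore a nonzero constant times the number of linear
combinations of the rows of `M` that give `β` (`exists_value_bipM`), and the support of the value is
the row space of `M` (`value_bipM_ne_zero_iff`). Proportional maps have the same support, so their
normal forms have the same row space.

What remains is linear algebra by rewriting. Strong complementarity followed by fusion removes an
internal X spider together with a Z spider joined to it by one edge, and replaces `M` by `M + s rᵀ`
(`bipM_elim`). A temporary X spider that can be removed through either of two Z spiders yields row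
addition (`bipM_row_add`); with one more temporary spider this gives cancellation of double edges
(`bipM_hopf`), so only `M` modulo 2 matters. Zero rows can be created freely, hence so can all rows
in the span, and two matrices with the same row space are both rewritten into the stacked matrix
(`bipM_of_span_eq`). The same elimination removes all internal X spiders and so produces the normal
form (`Diagram.exists_normal_form`).

Scalars need no bookkeeping. Rewriting is carried out up to an unknown factor `d`; by soundness
(`Derives.sound`) `d` relates the values of the two graphs. Since the zero vector lies in every row
space, the value at `β = 0` is nonzero, and comparing there gives `d = c`. -/

/-- Rewriting up to an unspecified scalar. -/
def Rw {m n : ℕ} (G H : Graph m n) : Prop := ∃ c, Derives c G H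

section RwBasic

variable {m n : ℕ} {G H K : Graph m n}

theorem Rw.symm (h : Rw G H) : Rw H G := h.imp' _ fun _ => Derives.symm

theorem Rw.trans (h : Rw G H) (h' : Rw H K) : Rw G K :=
  let ⟨_, d⟩ := h; let ⟨_, d'⟩ := h'; ⟨_, d.trans d'⟩

theorem Graph.Iso.rw (f : G.Iso H) : Rw G H := ⟨1, .iso f⟩

end RwBasic

theorem sym2_map_congr {α β : Type*} {f g : α → β} (h : ∀ x, f x = g x) (s : Sym2 α) :
    s.map f = s.map g := by
  rw [funext h]

theorem sym2_map_map_congr {α β γ δ : Type*} {f : α → β} {g : β → γ} {f' : α → δ} {g' : δ → γ}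
    (h : ∀ x, g (f x) = g' (f' x)) (s : Sym2 α) : (s.map f).map g = (s.map f').map g' := by
  rw [Sym2.map_map, Sym2.map_map]; exact sym2_map_congr h s

theorem sym2_map_eq_map_map {α β γ : Type*} {f : α → β} {g : β → γ} {f' : α → γ}
    (h : ∀ x, f' x = g (f x)) (s : Sym2 α) : s.map f' = (s.map f).map g := by
  rw [Sym2.map_map]; exact sym2_map_congr h s

/-- `(A ⊕ B) ⊕ C ≃ (A ⊕ C) ⊕ B`. -/
def sumRightSwap (A B C : Type*) : (A ⊕ B) ⊕ C ≃ (A ⊕ C) ⊕ B where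
  toFun := Sum.elim (Sum.elim (fun a => .inl (.inl a)) .inr) (fun c => .inl (.inr c))
  invFun := Sum.elim (Sum.elim (fun a => .inl (.inl a)) .inr) (fun c => .inl (.inr c))
  left_inv := by rintro ((_ | _) | _) <;> rfl
  right_inv := by rintro ((_ | _) | _) <;> rfl

/-! ## Contexts -/

section Context

variable {m n m' n' : ℕ} {V₁ E₁ : Type} [Finite V₁] [Finite E₁]

/-- How the vertices and ends of a graph sit inside a context. -/
def plug (V : Type) (φ : Bdry m n → V₁ ⊕ Bdry m' n') :
    V ⊕ Bdry m n → (V ⊕ V₁) ⊕ Bdry m' n' :=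
  Sum.elim (fun v => .inl (.inl v)) (fun b => Sum.map .inr id (φ b))

/-- The edges of a graph plugged into a context. -/
def plugEnds {V E : Type} (ends : E → Sym2 (V ⊕ Bdry m n)) (ends₁ : E₁ → Sym2 (V₁ ⊕ Bdry m' n'))
    (φ : Bdry m n → V₁ ⊕ Bdry m' n') : E ⊕ E₁ → Sym2 ((V ⊕ V₁) ⊕ Bdry m' n') :=
  Sum.elim (fun e => (ends e).map (plug V φ)) (fun e => (ends₁ e).map (Sum.map .inr id))

/-- A graph inside a context; the ends of the graph are attached according to `φ`. -/
def Graph.ctx (G : Graph m n) (kind₁ : V₁ → Kind) (ends₁ : E₁ → Sym2 (V₁ ⊕ Bdry m' n'))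
    (φ : Bdry m n → V₁ ⊕ Bdry m' n') : Graph m' n' :=
  haveI := G.finV; haveI := G.finE
  { V := G.V ⊕ V₁
    E := G.E ⊕ E₁
    kind := Sum.elim G.kind kind₁
    ends := plugEnds G.ends ends₁ φ }

variable (kind₁ : V₁ → Kind) (ends₁ : E₁ → Sym2 (V₁ ⊕ Bdry m' n'))
  (φ : Bdry m n → V₁ ⊕ Bdry m' n')

variable {V₀ E₀ : Type} [Finite V₀] [Finite E₀]

/-- Each rule already speaks of an arbitrary remainder `kind₀`, `ends₀` of the graph. Plugging into
a context only enlarges that remainder, so up to reordering of vertices and edges the result is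
again a side of the same rule. -/
def ctxMidVertex (k : Kind) (kind₀ : V₀ → Kind) (ends₀ : E₀ → Sym2 (V₀ ⊕ Bdry m n))
    (a b : V₀ ⊕ Bdry m n) :
    ((midVertex k kind₀ ends₀ a b).ctx kind₁ ends₁ φ).Iso
      (midVertex k (Sum.elim kind₀ kind₁) (plugEnds ends₀ ends₁ φ) (plug V₀ φ a) (plug V₀ φ b)) where
  onV := sumRightSwap _ _ _
  onE := sumRightSwap _ _ _
  kind_eq := by rintro ((_ | _) | _) <;> rfl
  ends_eq := by
    have key : ∀ x : V₀ ⊕ Bdry m n, Sum.map Sum.inl id (plug V₀ φ x) =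
        Sum.map (sumRightSwap V₀ Unit V₁) id (plug (V₀ ⊕ Unit) φ (Sum.map Sum.inl id x)) := by
      rintro (v | v)
      · rfl
      · simp only [plug, Sum.map_inr, Sum.elim_inr, id]
        rcases φ v with w | w <;> rfl
    rintro ((e | e) | e)
    · exact (sym2_map_map_congr key (ends₀ e)).trans
        (congrArg (Sym2.map _) (Sym2.map_map ..).symm)
    · fin_cases e
      · exact congrArg (fun x => s(x, _)) (key a)
      · exact congrArg (fun x => s(_, x)) (key b)
    · exact sym2_map_map_congr (by rintro (_ | _) <;> rfl) _

def ctxPlainWire (kind₀ : V₀ → Kind) (ends₀ : E₀ → Sym2 (V₀ ⊕ Bdry m n))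
    (a b : V₀ ⊕ Bdry m n) :
    ((plainWire kind₀ ends₀ a b).ctx kind₁ ends₁ φ).Iso
      (plainWire (Sum.elim kind₀ kind₁) (plugEnds ends₀ ends₁ φ) (plug V₀ φ a) (plug V₀ φ b)) where
  onV := .refl _
  onE := sumRightSwap _ _ _
  kind_eq := fun _ => rfl
  ends_eq := by
    have key : Sum.map (Equiv.refl (V₀ ⊕ V₁)) (id : Bdry m' n' → _) = id := by
      ext (_ | _) <;> rfl
    intro e
    refine Eq.trans ?_ (congrFun (congrArg Sym2.map key.symm) _)
    rw [Sym2.map_id]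
    rcases e with (e | e) | e <;> rfl

def ctxFuseLHS (c : Color) (p : ℕ) (kind₀ : V₀ → Kind)
    (ends₀ : E₀ → Sym2 ((V₀ ⊕ Fin 2) ⊕ Bdry m n)) :
    ((fuseLHS c p kind₀ ends₀).ctx kind₁ ends₁ φ).Iso
      (fuseLHS c p (Sum.elim kind₀ kind₁)
        (fun e => (plugEnds ends₀ ends₁ φ e).map (Sum.map (sumRightSwap _ _ _) id))) where
  onV := sumRightSwap _ _ _
  onE := sumRightSwap _ _ _
  kind_eq := by rintro ((_ | _) | _) <;> rfl
  ends_eq := by rintro ((e | e) | e) <;> rfl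

def ctxFuseRHS (c : Color) (kind₀ : V₀ → Kind)
    (ends₀ : E₀ → Sym2 ((V₀ ⊕ Fin 2) ⊕ Bdry m n)) :
    ((fuseRHS c kind₀ ends₀).ctx kind₁ ends₁ φ).Iso
      (fuseRHS c (Sum.elim kind₀ kind₁)
        (fun e => (plugEnds ends₀ ends₁ φ e).map (Sum.map (sumRightSwap _ _ _) id))) where
  onV := sumRightSwap _ _ _
  onE := .refl _
  kind_eq := by rintro ((_ | _) | _) <;> rfl
  ends_eq := by
    rintro (e | e)
    · refine Eq.trans (Sym2.map_map ..) (Eq.trans (sym2_map_map_congr ?_ _) (Sym2.map_map ..).symm)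
      rintro ((v | v) | v)
      · rfl
      · rfl
      · change Sum.map (Sum.map id fun _ => ()) id (Sum.map (sumRightSwap V₀ (Fin 2) V₁) id
            (Sum.map Sum.inr id (φ v))) = Sum.map (sumRightSwap V₀ Unit V₁) id
            (Sum.map Sum.inr id (φ v))
        rcases φ v with w | w <;> rfl
    · refine Eq.trans (Sym2.map_map ..) (sym2_map_map_congr ?_ _)
      rintro (_ | _) <;> rfl

def ctxScLHS (p q : ℕ) (kind₀ : V₀ → Kind) (ends₀ : E₀ → Sym2 (V₀ ⊕ Bdry m n))
    (a : Fin p → V₀ ⊕ Bdry m n) (b : Fin q → V₀ ⊕ Bdry m n) :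
    ((scLHS p q kind₀ ends₀ a b).ctx kind₁ ends₁ φ).Iso
      (scLHS p q (Sum.elim kind₀ kind₁) (plugEnds ends₀ ends₁ φ)
        (fun i => plug V₀ φ (a i)) (fun j => plug V₀ φ (b j))) where
  onV := sumRightSwap _ _ _
  onE := (sumRightSwap _ _ _).trans (.sumCongr (sumRightSwap _ _ _) (.refl _))
  kind_eq := by rintro ((_ | _) | _) <;> rfl
  ends_eq := by
    have key : ∀ x : V₀ ⊕ Bdry m n, Sum.map Sum.inl id (plug V₀ φ x) =
        Sum.map (sumRightSwap V₀ (Fin 2) V₁) id (plug (V₀ ⊕ Fin 2) φ (Sum.map Sum.inl id x)) := by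
      rintro (v | v)
      · rfl
      · simp only [plug, Sum.map_inr, Sum.elim_inr, id]
        rcases φ v with w | w <;> rfl
    rintro (((e | e) | (e | e)) | e)
    · exact (sym2_map_map_congr key (ends₀ e)).trans
        (congrArg (Sym2.map _) (Sym2.map_map ..).symm)
    · rfl
    · exact congrArg (fun x => s(x, _)) (key (a e))
    · exact congrArg (fun x => s(_, x)) (key (b e))
    · exact sym2_map_map_congr (by rintro (_ | _) <;> rfl) _

def ctxScRHS (p q : ℕ) (kind₀ : V₀ → Kind) (ends₀ : E₀ → Sym2 (V₀ ⊕ Bdry m n))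
    (a : Fin p → V₀ ⊕ Bdry m n) (b : Fin q → V₀ ⊕ Bdry m n) :
    ((scRHS p q kind₀ ends₀ a b).ctx kind₁ ends₁ φ).Iso
      (scRHS p q (Sum.elim kind₀ kind₁) (plugEnds ends₀ ends₁ φ)
        (fun i => plug V₀ φ (a i)) (fun j => plug V₀ φ (b j))) where
  onV := sumRightSwap _ _ _
  onE := (sumRightSwap _ _ _).trans (.sumCongr (sumRightSwap _ _ _) (.refl _))
  kind_eq := by rintro ((_ | (_ | _)) | _) <;> rfl
  ends_eq := by
    have key : ∀ x : V₀ ⊕ Bdry m n, Sum.map Sum.inl id (plug V₀ φ x) =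
        Sum.map (sumRightSwap V₀ (Fin p ⊕ Fin q) V₁) id
          (plug (V₀ ⊕ (Fin p ⊕ Fin q)) φ (Sum.map Sum.inl id x)) := by
      rintro (v | v)
      · rfl
      · simp only [plug, Sum.map_inr, Sum.elim_inr, id]
        rcases φ v with w | w <;> rfl
    rintro (((e | e) | (e | e)) | e)
    · exact (sym2_map_map_congr key (ends₀ e)).trans
        (congrArg (Sym2.map _) (Sym2.map_map ..).symm)
    · rfl
    · exact congrArg (fun x => s(x, _)) (key (a e))
    · exact congrArg (fun x => s(_, x)) (key (b e))
    · exact sym2_map_map_congr (by rintro (_ | _) <;> rfl) _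

def Graph.Iso.ctx {G H : Graph m n} (f : G.Iso H) :
    (G.ctx kind₁ ends₁ φ).Iso (H.ctx kind₁ ends₁ φ) where
  onV := .sumCongr f.onV (.refl _)
  onE := .sumCongr f.onE (.refl _)
  kind_eq := by
    rintro (v | v)
    · exact f.kind_eq v
    · rfl
  ends_eq := by
    rintro (e | e)
    · refine Eq.trans (congrArg (Sym2.map _) (f.ends_eq e)) (sym2_map_map_congr ?_ _)
      rintro (v | v)
      · rfl
      · simp only [plug, Sum.map_inr, Sum.elim_inr, id]
        rcases φ v with w | w <;> rfl
    · exact sym2_map_eq_map_map (by rintro (_ | _) <;> rfl) _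

/-- Induction on the derivation. It is needed because sequential and parallel composition place each
factor in a context, so that diagrams can be treated by structural induction. -/
theorem Rw.ctx {G H : Graph m n} (h : Rw G H) :
    Rw (G.ctx kind₁ ends₁ φ) (H.ctx kind₁ ends₁ φ) := by
  obtain ⟨c, h⟩ := h
  induction h with
  | symm _ ih => exact ih.symm
  | trans _ _ ih ih' => exact ih.trans ih'
  | iso f => exact (f.ctx _ _ _).rw
  | point kind₀ ends₀ a b =>
    exact (ctxMidVertex ..).rw.trans (.trans ⟨_, .point ..⟩ (ctxPlainWire ..).rw.symm)
  | ident c kind₀ ends₀ a b =>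
    exact (ctxMidVertex ..).rw.trans (.trans ⟨_, .ident c ..⟩ (ctxPlainWire ..).rw.symm)
  | fuse c p kind₀ ends₀ =>
    exact (ctxFuseLHS ..).rw.trans (.trans ⟨_, .fuse c p ..⟩ (ctxFuseRHS ..).rw.symm)
  | sc p q kind₀ ends₀ a b =>
    exact (ctxScLHS ..).rw.trans (.trans ⟨_, .sc p q ..⟩ (ctxScRHS ..).rw.symm)

end Context

section Families

variable {m n : ℕ} {V₀ E₀ : Type} [Finite V₀] [Finite E₀]

/-! ## Families of vertices on wires -/

theorem midVertex_rw (k : Kind) (kind₀ : V₀ → Kind) (ends₀ : E₀ → Sym2 (V₀ ⊕ Bdry m n))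
    (a b : V₀ ⊕ Bdry m n) : Rw (midVertex k kind₀ ends₀ a b) (plainWire kind₀ ends₀ a b) := by
  cases k with
  | spider c => exact ⟨_, .ident c ..⟩
  | wire => exact ⟨_, .point ..⟩

/-- A family of vertices of degree two, the `k`-th one on a wire between `a k` and `b k`. -/
def midVertices {K : Type} [Finite K] (kind₁ : K → Kind) (kind₀ : V₀ → Kind)
    (ends₀ : E₀ → Sym2 (V₀ ⊕ Bdry m n)) (a b : K → V₀ ⊕ Bdry m n) : Graph m n where
  V := V₀ ⊕ K
  E := E₀ ⊕ (K ⊕ K)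
  kind := Sum.elim kind₀ kind₁
  ends := Sum.elim (fun e => (ends₀ e).map (Sum.map .inl id))
    (Sum.elim (fun k => s(Sum.map .inl id (a k), .inl (.inr k)))
      (fun k => s(.inl (.inr k), Sum.map .inl id (b k))))

/-- A family of plain wires, the `k`-th one between `a k` and `b k`. -/
def plainWires {K : Type} [Finite K] (kind₀ : V₀ → Kind)
    (ends₀ : E₀ → Sym2 (V₀ ⊕ Bdry m n)) (a b : K → V₀ ⊕ Bdry m n) : Graph m n where
  V := V₀
  E := E₀ ⊕ K
  kind := kind₀
  ends := Sum.elim ends₀ (fun k => s(a k, b k))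

theorem sym2_map_id_of {α : Type*} {f : α → α} (h : ∀ x, f x = x) (s : Sym2 α) : s.map f = s := by
  rw [show f = id from funext h, Sym2.map_id]; rfl

theorem midVertices_rw {K : Type} [Finite K] (kind₁ : K → Kind) (kind₀ : V₀ → Kind)
    (ends₀ : E₀ → Sym2 (V₀ ⊕ Bdry m n)) (a b : K → V₀ ⊕ Bdry m n) :
    Rw (midVertices kind₁ kind₀ ends₀ a b) (plainWires kind₀ ends₀ a b) := by
  -- The remaining edges must vary: a vertex that has been removed leaves a plain wire, which joins
  -- them for the next step.
  suffices H : ∀ (E₀ : Type) [Finite E₀] (ends₀ : E₀ → Sym2 (V₀ ⊕ Bdry m n))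
      (kind₁ : K → Kind) (a b : K → V₀ ⊕ Bdry m n),
      Rw (midVertices kind₁ kind₀ ends₀ a b) (plainWires kind₀ ends₀ a b) from H ..
  clear * -
  refine Finite.induction_empty_option (P := fun K => ∀ [Finite K] (E₀ : Type) [Finite E₀]
      (ends₀ : E₀ → Sym2 (V₀ ⊕ Bdry m n)) (kind₁ : K → Kind) (a b : K → V₀ ⊕ Bdry m n),
      Rw (midVertices kind₁ kind₀ ends₀ a b) (plainWires kind₀ ends₀ a b)) ?_ ?_ ?_ K
  · intro K K' f ih _ E₀ _ ends₀ kind₁ a b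
    have := Finite.of_equiv K' f.symm
    refine Rw.trans (Graph.Iso.rw ?_) ((ih E₀ ends₀ (kind₁ ∘ f) (a ∘ f) (b ∘ f)).trans
      (Graph.Iso.rw ?_))
    · refine Graph.Iso.mk (.sumCongr (.refl _) f.symm)
        (.sumCongr (.refl _) (.sumCongr f.symm f.symm)) ?_ ?_
      · rintro (v | v)
        · rfl
        · exact congrArg kind₁ (f.apply_symm_apply v)
      · have key : ∀ x : V₀ ⊕ Bdry m n, Sum.map Sum.inl id x = Sum.map
            (Equiv.sumCongr (Equiv.refl V₀) f.symm) id (Sum.map Sum.inl id x) := by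
          rintro (_ | _) <;> rfl
        rintro (e | e | e)
        · exact sym2_map_eq_map_map key _
        · exact congrArg (s(·, _)) ((congrArg (fun k => Sum.map _ _ (a k))
            (f.apply_symm_apply e)).trans (key _))
        · exact congrArg (s(_, ·)) ((congrArg (fun k => Sum.map _ _ (b k))
            (f.apply_symm_apply e)).trans (key _))
    · refine Graph.Iso.mk (.refl _) (.sumCongr (.refl _) f) (fun _ => rfl) ?_
      intro e
      refine Eq.trans ?_ (sym2_map_id_of (by rintro (_ | _) <;> rfl) _).symm
      rcases e with e | e <;> rfl
  · intro _ E₀ _ ends₀ kind₁ a b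
    refine Graph.Iso.rw (Graph.Iso.mk (.sumEmpty _ _)
      (.sumCongr (.refl _) (.sumEmpty _ _)) ?_ ?_)
    · rintro (v | v)
      · rfl
      · exact v.elim
    · rintro (e | e | e)
      · refine Eq.trans (sym2_map_id_of ?_ _).symm (Sym2.map_map ..).symm
        rintro (_ | _) <;> rfl
      · exact e.elim
      · exact e.elim
  · intro K _ ih _ E₀ _ ends₀ kind₁ a b
    have h1 := midVertex_rw (V₀ := V₀ ⊕ K) (E₀ := E₀ ⊕ (K ⊕ K)) (kind₁ none)
      (Sum.elim kind₀ (kind₁ ∘ some))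
      (midVertices (kind₁ ∘ some) kind₀ ends₀ (a ∘ some) (b ∘ some)).ends
      (Sum.map .inl id (a none)) (Sum.map .inl id (b none))
    have h2 := ih (E₀ ⊕ Unit) (Sum.elim ends₀ fun _ => s(a none, b none)) (kind₁ ∘ some)
      (a ∘ some) (b ∘ some)
    refine Rw.trans (Graph.Iso.rw ?_) (h1.trans (Rw.trans (Graph.Iso.rw ?_)
      (h2.trans (Graph.Iso.rw ?_))))
    · refine Graph.Iso.mk
        ⟨Sum.elim (fun v => .inl (.inl v)) fun o => o.elim (.inr ()) fun k => .inl (.inr k),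
          Sum.elim (Sum.elim .inl fun k => .inr (some k)) fun _ => .inr none, ?_, ?_⟩
        ⟨Sum.elim (fun e => .inl (.inl e)) (Sum.elim
            (fun o => o.elim (.inr 0) fun k => .inl (.inr (.inl k)))
            (fun o => o.elim (.inr 1) fun k => .inl (.inr (.inr k)))),
          Sum.elim (Sum.elim .inl
            (Sum.elim (fun k => .inr (.inl (some k))) fun k => .inr (.inr (some k))))
            ![.inr (.inl none), .inr (.inr none)], ?_, ?_⟩ ?_ ?_
      · rintro (_ | _ | _) <;> rfl
      · rintro ((_ | _) | _) <;> rfl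
      · rintro (_ | (_ | _) | (_ | _)) <;> rfl
      · rintro ((_ | _ | _) | e)
        · rfl
        · rfl
        · rfl
        · fin_cases e <;> rfl
      · rintro (_ | _ | _) <;> rfl
      · have key : ∀ x : V₀ ⊕ Bdry m n, Sum.map Sum.inl id (Sum.map Sum.inl id x) = Sum.map
            (Sum.elim (fun v => Sum.inl (Sum.inl v)) fun o : Option K =>
              o.elim (Sum.inr ()) fun k => Sum.inl (Sum.inr k)) id (Sum.map Sum.inl id x) := by
          rintro (_ | _) <;> rfl
        rintro (e | (_ | e) | (_ | e))
        · exact sym2_map_map_congr key _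
        · exact congrArg (s(·, _)) (key _)
        · exact congrArg (s(·, _)) (key _)
        · exact congrArg (s(_, ·)) (key _)
        · exact congrArg (s(_, ·)) (key _)
    · refine Graph.Iso.mk (.refl _) (sumRightSwap _ _ _) (fun _ => rfl) ?_
      intro e
      refine Eq.trans ?_ (sym2_map_id_of (by rintro (_ | _) <;> rfl) _).symm
      rcases e with (e | e | e) | e <;> rfl
    · refine Graph.Iso.mk (.refl _)
        ⟨Sum.elim (Sum.elim .inl fun _ => .inr none) fun k => .inr (some k),
          Sum.elim (fun e => .inl (.inl e)) fun o => o.elim (.inl (.inr ())) .inr, ?_, ?_⟩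
        (fun _ => rfl) ?_
      · rintro ((_ | _) | _) <;> rfl
      · rintro (_ | _ | _) <;> rfl
      · intro e
        refine Eq.trans ?_ (sym2_map_id_of (by rintro (_ | _) <;> rfl) _).symm
        rcases e with (e | e) | e <;> rfl

/-! ## Absorbing spiders into neighbours of the same colour -/

/-- An additional vertex, joined to `v` by `p + 1` edges. -/
def pendant (p : ℕ) (k : Kind) (kind₀ : V₀ → Kind)
    (ends₀ : E₀ → Sym2 ((V₀ ⊕ Unit) ⊕ Bdry m n)) (v : V₀) : Graph m n where
  V := V₀ ⊕ Unit
  E := E₀ ⊕ Fin (p + 1)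
  kind := Sum.elim kind₀ fun _ => k
  ends := Sum.elim ends₀ fun _ => s(.inl (.inl v), .inl (.inr ()))

/-- The additional vertex is merged into `v`. -/
def absorbed (kind₀ : V₀ → Kind) (ends₀ : E₀ → Sym2 ((V₀ ⊕ Unit) ⊕ Bdry m n)) (v : V₀) :
    Graph m n where
  V := V₀
  E := E₀
  kind := kind₀
  ends := fun e => (ends₀ e).map (Sum.map (Sum.elim id fun _ => v) id)

/-- The rule `fuse` wants its two spiders as a separate summand `Fin 2`, so the vertices are
regrouped into those other than `v`, and the pair of `v` and the new vertex. -/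
theorem pendant_rw (p : ℕ) (c : Color) (kind₀ : V₀ → Kind)
    (ends₀ : E₀ → Sym2 ((V₀ ⊕ Unit) ⊕ Bdry m n)) (v : V₀) (hv : kind₀ v = .spider c) :
    Rw (pendant p (.spider c) kind₀ ends₀ v) (absorbed kind₀ ends₀ v) := by
  classical
  let f : V₀ ⊕ Unit ≃ {w : V₀ // w ≠ v} ⊕ Fin 2 :=
    ⟨Sum.elim (fun w => if h : w = v then .inr 0 else .inl ⟨w, h⟩) fun _ => .inr 1,
      Sum.elim (fun w => .inl w) ![.inl v, .inr ()], by
        rintro (w | w)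
        · by_cases h : w = v <;> simp [h]
        · rfl, by
        rintro (w | w)
        · simp [w.2]
        · fin_cases w <;> simp⟩
  let g : V₀ ≃ {w : V₀ // w ≠ v} ⊕ Unit :=
    ⟨fun w => if h : w = v then .inr () else .inl ⟨w, h⟩, Sum.elim (fun w => w) fun _ => v, by
        intro w
        by_cases h : w = v <;> simp [h], by
        rintro (w | w)
        · simp [w.2]
        · simp⟩
  have fv : f (.inl v) = .inr 0 := by simp [f]
  have fg : ∀ x, Sum.map id (fun _ => ()) (f x) = g (Sum.elim id (fun _ => v) x) := by
    rintro (w | w)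
    · by_cases h : w = v <;> simp [f, g, h]
    · simp [f, g]
  let ends₁ : E₀ → Sym2 (({w : V₀ // w ≠ v} ⊕ Fin 2) ⊕ Bdry m n) :=
    fun e => (ends₀ e).map (Sum.map f id)
  let kind₁ : {w : V₀ // w ≠ v} → Kind := fun w => kind₀ w.1
  have i1 : (pendant p (.spider c) kind₀ ends₀ v).Iso (fuseLHS c p kind₁ ends₁) := by
    refine ⟨f, .refl _, ?_, ?_⟩
    · rintro (w | w)
      · change Sum.elim kind₁ (fun _ => .spider c) (f (.inl w)) = kind₀ w
        by_cases h : w = v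
        · rw [h, fv, hv]; rfl
        · simp [f, h, kind₁]
      · rfl
    · rintro (e | e)
      · rfl
      · exact congrArg (fun x => s(Sum.inl x, Sum.inl (Sum.inr 1))) fv.symm
  have i2 : (absorbed kind₀ ends₀ v).Iso (fuseRHS c kind₁ ends₁) := by
    refine ⟨g, .refl _, ?_, ?_⟩
    · intro (w : V₀)
      change Sum.elim kind₁ (fun _ => .spider c) (g w) = kind₀ w
      by_cases h : w = v
      · simp [g, h, hv]
      · simp [g, h, kind₁]
    · intro e
      refine sym2_map_map_congr ?_ _
      rintro (x | x)
      · exact congrArg Sum.inl (fg x)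
      · rfl
  exact i1.rw.trans (.trans ⟨_, .fuse c p ..⟩ i2.rw.symm)

/-- A family of additional vertices, the `k`-th one joined to `v k` by one edge. -/
def pendants {K : Type} [Finite K] (kind₀ : V₀ → Kind)
    (ends₀ : E₀ → Sym2 ((V₀ ⊕ K) ⊕ Bdry m n)) (v : K → V₀) : Graph m n where
  V := V₀ ⊕ K
  E := E₀ ⊕ K
  kind := Sum.elim kind₀ fun k => kind₀ (v k)
  ends := Sum.elim ends₀ fun k => s(.inl (.inl (v k)), .inl (.inr k))

/-- The additional vertices are merged into the `v k`. -/
def absorbeds {K : Type} (kind₀ : V₀ → Kind) (ends₀ : E₀ → Sym2 ((V₀ ⊕ K) ⊕ Bdry m n))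
    (v : K → V₀) : Graph m n where
  V := V₀
  E := E₀
  kind := kind₀
  ends := fun e => (ends₀ e).map (Sum.map (Sum.elim id v) id)

theorem pendants_rw {K : Type} [Finite K] (kind₀ : V₀ → Kind)
    (ends₀ : E₀ → Sym2 ((V₀ ⊕ K) ⊕ Bdry m n)) (v : K → V₀)
    (hv : ∀ k, ∃ c, kind₀ (v k) = .spider c) :
    Rw (pendants kind₀ ends₀ v) (absorbeds kind₀ ends₀ v) := by
  suffices H : ∀ (E₀ : Type) [Finite E₀] (ends₀ : E₀ → Sym2 ((V₀ ⊕ K) ⊕ Bdry m n)) (v : K → V₀)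
      (_ : ∀ k, ∃ c, kind₀ (v k) = .spider c),
      Rw (pendants kind₀ ends₀ v) (absorbeds kind₀ ends₀ v) from H _ _ _ hv
  clear * -
  refine Finite.induction_empty_option (P := fun K => ∀ [Finite K] (E₀ : Type) [Finite E₀]
      (ends₀ : E₀ → Sym2 ((V₀ ⊕ K) ⊕ Bdry m n)) (v : K → V₀)
      (_ : ∀ k, ∃ c, kind₀ (v k) = .spider c),
      Rw (pendants kind₀ ends₀ v) (absorbeds kind₀ ends₀ v)) ?_ ?_ ?_ K
  · intro K K' f ih _ E₀ _ ends₀ v hv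
    have := Finite.of_equiv K' f.symm
    refine Rw.trans (Graph.Iso.rw ?_) ((ih E₀ (fun e => (ends₀ e).map
      (Sum.map (Sum.map id f.symm) id)) (v ∘ f) (fun k => hv _)).trans (Graph.Iso.rw ?_))
    · refine Graph.Iso.mk (.sumCongr (.refl _) f.symm) (.sumCongr (.refl _) f.symm) ?_ ?_
      · rintro (w | w)
        · rfl
        · exact congrArg (fun k => kind₀ (v k)) (f.apply_symm_apply w)
      · rintro (e | e)
        · exact sym2_map_congr (by rintro ((_ | _) | _) <;> rfl) _
        · exact congrArg (fun k => s(Sum.inl (Sum.inl (v k)), Sum.inl (Sum.inr (f.symm e))))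
            (f.apply_symm_apply e)
    · refine Graph.Iso.mk (.refl _) (.refl _) (fun _ => rfl) ?_
      intro e
      refine Eq.trans ?_ (sym2_map_id_of (by rintro (_ | _) <;> rfl) _).symm
      refine sym2_map_eq_map_map ?_ _
      rintro ((w | w) | w)
      · rfl
      · exact congrArg (fun k => Sum.inl (v k)) (f.apply_symm_apply w).symm
      · rfl
  · intro _ E₀ _ ends₀ v _
    refine Graph.Iso.rw (Graph.Iso.mk (.sumEmpty _ _) (.sumEmpty _ _) ?_ ?_)
    · rintro (w | w)
      · rfl
      · exact w.elim
    · rintro (e | e)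
      · refine sym2_map_congr ?_ _
        rintro ((w | w) | w)
        · rfl
        · exact w.elim
        · rfl
      · exact e.elim
  · intro K _ ih _ E₀ _ ends₀ v hv
    obtain ⟨c, hc⟩ := hv none
    let f : V₀ ⊕ Option K ≃ (V₀ ⊕ K) ⊕ Unit :=
      ⟨Sum.elim (fun v => .inl (.inl v)) fun o => o.elim (.inr ()) fun k => .inl (.inr k),
        Sum.elim (Sum.elim .inl fun k => .inr (some k)) fun _ => .inr none,
        by rintro (_ | _ | _) <;> rfl, by rintro ((_ | _) | _) <;> rfl⟩
    -- While the vertex `none` is merged, the edges to the other pendant vertices count as ordinary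
    -- edges.
    let ends₁ : E₀ ⊕ K → Sym2 (((V₀ ⊕ K) ⊕ Unit) ⊕ Bdry m n) :=
      Sum.elim (fun e => (ends₀ e).map (Sum.map f id))
        fun k => s(.inl (.inl (.inl (v (some k)))), .inl (.inl (.inr k)))
    have h1 := pendant_rw 0 c (Sum.elim kind₀ fun k => kind₀ (v (some k))) ends₁ (.inl (v none)) hc
    have h2 := ih E₀ (fun e => (ends₁ (.inl e)).map (Sum.map (Sum.elim id fun _ => .inl (v none)) id))
      (v ∘ some) (fun k => hv _)
    refine Rw.trans (Graph.Iso.rw ?_) (h1.trans (Rw.trans (Graph.Iso.rw ?_)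
      (h2.trans (Graph.Iso.rw ?_))))
    · refine Graph.Iso.mk f
        ⟨Sum.elim (fun e => .inl (.inl e)) fun o => o.elim (.inr 0) fun k => .inl (.inr k),
          Sum.elim (Sum.elim .inl fun k => .inr (some k)) fun _ => .inr none, ?_, ?_⟩ ?_ ?_
      · rintro (_ | _ | _) <;> rfl
      · rintro ((_ | _) | e)
        · rfl
        · rfl
        · fin_cases e; rfl
      · rintro (_ | _ | _)
        · rfl
        · exact hc.symm
        · rfl
      · rintro (e | _ | e) <;> rfl
    · refine Graph.Iso.mk (.refl _) (.refl _) (fun _ => rfl) ?_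
      intro e
      refine Eq.trans ?_ (sym2_map_id_of (by rintro (_ | _) <;> rfl) _).symm
      rcases e with e | e <;> rfl
    · refine Graph.Iso.mk (.refl _) (.refl _) (fun _ => rfl) ?_
      intro e
      refine Eq.trans ?_ (sym2_map_id_of (by rintro (_ | _) <;> rfl) _).symm
      refine Eq.trans (sym2_map_eq_map_map ?_ (ends₀ e)) (Sym2.map_map ..).symm
      rintro ((w | _ | w) | w) <;> rfl

/-! ## Loops -/

/-- A graph given by its data. -/
def bare (kind₀ : V₀ → Kind) (ends₀ : E₀ → Sym2 (V₀ ⊕ Bdry m n)) : Graph m n where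
  V := V₀
  E := E₀
  kind := kind₀
  ends := ends₀

/-- A vertex of degree two both of whose edges go to the same spider can be removed. -/
theorem midVertex_loop_rw (k : Kind) (kind₀ : V₀ → Kind) (ends₀ : E₀ → Sym2 (V₀ ⊕ Bdry m n))
    (v : V₀) {c : Color} (hv : kind₀ v = .spider c) :
    Rw (midVertex k kind₀ ends₀ (.inl v) (.inl v)) (bare kind₀ ends₀) := by
  -- `fuse` needs two distinct spiders, so it cannot delete a loop directly. The vertex is replaced,
  -- via the plain loop, by a spider of the colour of `v`; that spider is joined to `v` by two
  -- edges, and one fusion with `p = 1` consumes both.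
  refine (midVertex_rw k kind₀ ends₀ _ _).trans
    ((midVertex_rw (.spider c) kind₀ ends₀ _ _).symm.trans ?_)
  refine Rw.trans (Graph.Iso.rw ?_) ((pendant_rw 1 c kind₀
    (fun e => (ends₀ e).map (Sum.map .inl id)) v hv).trans (Graph.Iso.rw ?_))
  · refine Graph.Iso.mk (.refl _) (.refl _) (fun _ => rfl) ?_
    intro e
    refine Eq.trans ?_ (sym2_map_id_of (by rintro (_ | _) <;> rfl) _).symm
    rcases e with e | e
    · rfl
    · fin_cases e
      · rfl
      · exact Sym2.eq_swap
  · refine Graph.Iso.mk (.refl _) (.refl _) (fun _ => rfl) ?_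
    intro e
    refine Eq.trans ?_ (sym2_map_id_of (by rintro (_ | _) <;> rfl) _).symm
    refine Eq.trans (sym2_map_id_of ?_ _).symm (Sym2.map_map ..).symm
    rintro (_ | _) <;> rfl

end Families

section Bipartite

variable {m n : ℕ} {A J E : Type} [Finite A] [Finite J] [Finite E]

/-! ## Bipartite graphs -/

/-- A graph with Z spiders `A`, X spiders `J`, edges `E` between them, and every input and output
attached to an X spider. -/
def bip (f : E → A × J) (t : Bdry m n → J) : Graph m n where
  V := A ⊕ J
  E := E ⊕ Bdry m n
  kind := Sum.elim (fun _ => .spider .z) fun _ => .spider .x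
  ends := Sum.elim (fun e => s(.inl (.inl (f e).1), .inl (.inr (f e).2)))
    fun b => s(.inl (.inr (t b)), .inr b)

theorem bip_congr {A' J' E' : Type} [Finite A'] [Finite J'] [Finite E'] {f : E → A × J}
    {t : Bdry m n → J} {f' : E' → A' × J'} {t' : Bdry m n → J'} (eA : A ≃ A') (eJ : J ≃ J')
    (eE : E ≃ E') (hf : ∀ e, f' (eE e) = (eA (f e).1, eJ (f e).2)) (ht : ∀ b, t' b = eJ (t b)) :
    Rw (bip f t) (bip f' t') := by
  refine Graph.Iso.rw ⟨.sumCongr eA eJ, .sumCongr eE (.refl _), ?_, ?_⟩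
  · rintro (_ | _) <;> rfl
  · rintro (e | b)
    · exact congrArg (fun x : A' × J' => s(Sum.inl (Sum.inl x.1), Sum.inl (Sum.inr x.2))) (hf e)
    · exact congrArg (fun x : J' => s(Sum.inl (Sum.inr x), Sum.inr b)) (ht b)

/-- The bipartite graph with given numbers of edges. -/
def bipM (M : A → J → ℕ) (t : Bdry m n → J) : Graph m n :=
  bip (E := Σ p : A × J, Fin (M p.1 p.2)) Sigma.fst t

theorem bip_rw_bipM (f : E → A × J) (t : Bdry m n → J) :
    Rw (bip f t) (bipM (fun a j => Nat.card {e // f e = (a, j)}) t) :=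
  bip_congr (.refl _) (.refl _) ((Equiv.sigmaFiberEquiv f).symm.trans
    (Equiv.sigmaCongrRight fun _ => Finite.equivFin _)) (fun _ => rfl) fun _ => rfl

theorem bipM_congr {A' J' : Type} [Finite A'] [Finite J'] {M : A → J → ℕ}
    {t : Bdry m n → J} {M' : A' → J' → ℕ} {t' : Bdry m n → J'} (eA : A ≃ A') (eJ : J ≃ J')
    (hM : ∀ a j, M' (eA a) (eJ j) = M a j) (ht : ∀ b, t' b = eJ (t b)) :
    Rw (bipM M t) (bipM M' t') :=
  bip_congr eA eJ (.sigmaCongr (.prodCongr eA eJ) fun _ => finCongr (hM _ _).symm)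
    (fun _ => rfl) ht

theorem card_fiber_sum {α β γ : Type*} [Finite α] [Finite β] (f : α ⊕ β → γ) (y : γ) :
    Nat.card {e // f e = y} = Nat.card {a // f (.inl a) = y} + Nat.card {b // f (.inr b) = y} := by
  rw [Nat.card_congr Equiv.subtypeSum, Nat.card_sum]

theorem card_fiber_sigma {α : Type*} (N : α → ℕ) (y : α) :
    Nat.card {e : Σ a, Fin (N a) // e.1 = y} = N y := by
  rw [Nat.card_congr (Equiv.sigmaSubtype y), Nat.card_fin]

theorem card_subtype_false {α : Type*} {p : α → Prop} (h : ∀ a, ¬ p a) :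
    Nat.card {a // p a} = 0 := by
  have : IsEmpty {a // p a} := ⟨fun a => h _ a.2⟩
  exact Nat.card_of_isEmpty

/-- A matrix with an additional row. -/
def addRow (M : A → J → ℕ) (r : J → ℕ) : A ⊕ Unit → J → ℕ := Sum.elim M fun _ => r

/-- A matrix with an additional column. -/
def addCol (M : A → J → ℕ) (s : A → ℕ) : A → J ⊕ Unit → ℕ := fun a => Sum.elim (M a) fun _ => s a

/-- A matrix with an additional row and an additional column, and the entry `1` in the corner. -/
def block (M : A → J → ℕ) (s : A → ℕ) (r : J → ℕ) : A ⊕ Unit → J ⊕ Unit → ℕ :=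
  addRow (addCol M s) (Sum.elim r fun _ => 1)

/-! ## Eliminating an internal X spider by strong complementarity -/

/-- Strong complementarity puts a Z spider on each further leg of the X spider and an X spider on
each further leg of the Z spider. Each new spider meets an old one of its own colour and fuses with
it; only the complete bipartite edges remain. -/
theorem elim_edges {p q : ℕ} (f : E → A × J) (s : Fin p → A) (r : Fin q → J)
    (t : Bdry m n → J) :
    Rw (bip (A := A ⊕ Unit) (J := J ⊕ Unit) (E := (E ⊕ Unit) ⊕ (Fin p ⊕ Fin q))
        (Sum.elim (Sum.elim (fun e => (.inl (f e).1, .inl (f e).2)) fun _ => (.inr (), .inr ()))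
          (Sum.elim (fun i => (.inl (s i), .inr ())) fun j => (.inr (), .inl (r j))))
        fun b => .inl (t b))
      (bip (A := A) (J := J) (E := E ⊕ Fin p × Fin q)
        (Sum.elim f fun ij => (s ij.1, r ij.2)) t) := by
  have h1 := Derives.sc (m := m) (n := n) p q (V₀ := A ⊕ J) (E₀ := E ⊕ Bdry m n) (bip f t).kind
    (bip f t).ends (fun i => .inl (.inl (s i))) fun j => .inl (.inr (r j))
  have h2 := pendants_rw (V₀ := A ⊕ J) (E₀ := (E ⊕ Bdry m n) ⊕ Fin p × Fin q) (K := Fin p ⊕ Fin q)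
    (bip f t).kind (Sum.elim (fun e => ((bip f t).ends e).map (Sum.map .inl id))
      (fun ij => s(.inl (.inr (.inl ij.1)), .inl (.inr (.inr ij.2)))))
    (Sum.elim (fun i => .inl (s i)) fun j => .inr (r j))
    (by rintro (_ | _) <;> exact ⟨_, rfl⟩)
  refine Rw.trans (Graph.Iso.rw ?_) (.trans ⟨_, h1⟩ (.trans (Graph.Iso.rw ?_)
    (h2.trans (Graph.Iso.rw ?_))))
  · refine Graph.Iso.mk
      ⟨Sum.elim (Sum.elim (fun a => .inl (.inl a)) fun _ => .inr 1)
          (Sum.elim (fun j => .inl (.inr j)) fun _ => .inr 0),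
        Sum.elim (Sum.elim (fun a => .inl (.inl a)) fun j => .inr (.inl j))
          ![.inr (.inr ()), .inl (.inr ())], ?_, ?_⟩
      ⟨Sum.elim (Sum.elim (Sum.elim (fun e => .inl (.inl (.inl e))) fun _ => .inl (.inr ())) .inr)
          fun b => .inl (.inl (.inr b)),
        Sum.elim (Sum.elim (Sum.elim (fun e => .inl (.inl (.inl e))) .inr)
          fun _ => .inl (.inl (.inr ()))) (fun e => .inl (.inr e)), ?_, ?_⟩ ?_ ?_
    · rintro ((_ | _) | (_ | _)) <;> rfl
    · rintro ((_ | _) | v)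
      · rfl
      · rfl
      · fin_cases v <;> rfl
    · rintro (((_ | _) | _) | _) <;> rfl
    · rintro (((_ | _) | _) | _) <;> rfl
    · rintro ((_ | _) | (_ | _)) <;> rfl
    · rintro (((_ | _) | (_ | _)) | _)
      · rfl
      · exact Sym2.eq_swap
      · rfl
      · rfl
      · rfl
  · refine Graph.Iso.mk (.refl _) (.refl _) ?_ ?_
    · rintro ((_ | _) | (_ | _)) <;> rfl
    · intro e
      refine Eq.trans ?_ (sym2_map_id_of (by rintro (_ | _) <;> rfl) _).symm
      rcases e with (_ | _) | (_ | _)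
      · rfl
      · rfl
      · rfl
      · exact Sym2.eq_swap
  · refine Graph.Iso.mk (.refl _) (sumRightSwap _ _ _) (fun _ => rfl) ?_
    intro e
    refine Eq.trans ?_ (sym2_map_id_of (by rintro (_ | _) <;> rfl) _).symm
    rcases e with (e | e) | e <;> rfl

theorem card_unit_subtype {p : Unit → Prop} (h : p ()) : Nat.card {a // p a} = 1 := by
  rw [Nat.card_eq_one_iff_unique]
  exact ⟨⟨fun _ _ => Subtype.ext rfl⟩, ⟨⟨(), h⟩⟩⟩

/-- An X spider without inputs or outputs is joined to the last Z spider by one edge; both are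
removed. -/
theorem bipM_elim (M : A → J → ℕ) (s : A → ℕ) (r : J → ℕ) (t : Bdry m n → J) :
    Rw (bipM (block M s r) fun b => .inl (t b)) (bipM (fun a j => M a j + s a * r j) t) := by
  -- Enumerations of the further legs of the two spiders, with multiplicity: a neighbour joined by
  -- several edges occurs several times.
  let eP := (Finite.equivFin (Σ a, Fin (s a))).symm
  let eQ := (Finite.equivFin (Σ j, Fin (r j))).symm
  have hP (a : A) : Nat.card {i // (eP i).1 = a} = s a := by
    rw [Nat.card_congr (eP.subtypeEquiv (q := fun x => x.1 = a) fun _ => Iff.rfl),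
      card_fiber_sigma]
  have hQ (j : J) : Nat.card {i // (eQ i).1 = j} = r j := by
    rw [Nat.card_congr (eQ.subtypeEquiv (q := fun x => x.1 = j) fun _ => Iff.rfl),
      card_fiber_sigma]
  have h := elim_edges (E := Σ p : A × J, Fin (M p.1 p.2)) Sigma.fst (fun i => (eP i).1)
    (fun j => (eQ j).1) t
  refine Rw.trans ?_ (((bip_rw_bipM _ _).symm.trans h).trans ((bip_rw_bipM _ _).trans ?_))
  · refine bipM_congr (.refl _) (.refl _) ?_ fun _ => rfl
    intro a j
    simp only [Equiv.refl_apply, card_fiber_sum, Sum.elim_inl, Sum.elim_inr]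
    rcases a with a | a <;> rcases j with j | j <;>
      simp only [Prod.mk.injEq, Sum.inl.injEq, reduceCtorEq, and_true, true_and,
        false_and, and_false, card_subtype_false, not_false_eq_true, implies_true, hP, hQ,
        zero_add, add_zero, block, addRow, addCol, Sum.elim_inl, Sum.elim_inr,
        card_unit_subtype]
    · exact ((card_fiber_sigma (fun p : A × J => M p.1 p.2) (a, j)).symm.trans
        (Nat.card_congr (Equiv.subtypeEquivRight fun e => Prod.ext_iff))).symm
  · refine bipM_congr (.refl _) (.refl _) ?_ fun _ => rfl
    intro a j
    simp only [Equiv.refl_apply, card_fiber_sum, Sum.elim_inl, Sum.elim_inr]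
    refine congrArg₂ (· + ·) (card_fiber_sigma (fun p : A × J => M p.1 p.2) (a, j)).symm ?_
    simp only [Prod.mk.injEq]
    rw [Nat.card_congr (Equiv.subtypeProdEquivProd (p := fun i => (eP i).1 = a)
      (q := fun i => (eQ i).1 = j)), Nat.card_prod, hP, hQ]

end Bipartite

section MatrixRules

variable {m n : ℕ} {A J E : Type} [Finite A] [Finite J] [Finite E]

theorem bipM_of_eq {M M' : A → J → ℕ} (h : ∀ a j, M a j = M' a j) (t : Bdry m n → J) :
    Rw (bipM M t) (bipM M' t) :=
  bipM_congr (.refl _) (.refl _) (fun a j => (h a j).symm) fun _ => rfl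

/-! ## Loops in bipartite graphs -/

theorem loop_x_edges (f : E → A × J) (t : Bdry m n → J) (u : A) :
    Rw (bip (A := A) (J := J ⊕ Unit) (E := E ⊕ Fin 2)
        (Sum.elim (fun e => ((f e).1, .inl (f e).2)) fun _ => (u, .inr ())) fun b => .inl (t b))
      (bip f t) := by
  have h := midVertex_loop_rw (V₀ := A ⊕ J) (E₀ := E ⊕ Bdry m n) (.spider .x)
    (bip f t).kind (bip f t).ends (.inl u) (c := .z) rfl
  refine Rw.trans (Graph.Iso.rw ?_) (h.trans (Graph.Iso.rw ?_))
  · refine Graph.Iso.mk (Equiv.sumAssoc _ _ _).symm (sumRightSwap _ _ _) ?_ ?_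
    · rintro (_ | _ | _) <;> rfl
    · rintro ((_ | e) | _)
      · rfl
      · fin_cases e
        · rfl
        · exact Sym2.eq_swap
      · rfl
  · refine Graph.Iso.mk (.refl _) (.refl _) (fun _ => rfl) ?_
    intro e
    exact (sym2_map_id_of (by rintro (_ | _) <;> rfl) _).symm

theorem loop_z_edges (f : E → A × J) (t : Bdry m n → J) (j : J) :
    Rw (bip (A := A ⊕ Unit) (J := J) (E := E ⊕ Fin 2)
        (Sum.elim (fun e => (.inl (f e).1, (f e).2)) fun _ => (.inr (), j)) t)
      (bip f t) := by
  have h := midVertex_loop_rw (V₀ := A ⊕ J) (E₀ := E ⊕ Bdry m n) (.spider .z)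
    (bip f t).kind (bip f t).ends (.inr j) (c := .x) rfl
  refine Rw.trans (Graph.Iso.rw ?_) (h.trans (Graph.Iso.rw ?_))
  · refine Graph.Iso.mk (sumRightSwap _ _ _) (sumRightSwap _ _ _) ?_ ?_
    · rintro ((_ | _) | _) <;> rfl
    · rintro ((_ | e) | _)
      · rfl
      · fin_cases e
        · exact Sym2.eq_swap
        · rfl
      · rfl
  · refine Graph.Iso.mk (.refl _) (.refl _) (fun _ => rfl) ?_
    intro e
    exact (sym2_map_id_of (by rintro (_ | _) <;> rfl) _).symm

theorem card_fiber_const {α β : Type*} [Finite α] (u y : β) [Decidable (y = u)] :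
    Nat.card {_e : α // u = y} = if y = u then Nat.card α else 0 := by
  split_ifs with h
  · exact Nat.card_congr (Equiv.subtypeUnivEquiv fun _ => h.symm)
  · exact card_subtype_false fun _ h' => h h'.symm

theorem bipM_loop_x [DecidableEq A] (M : A → J → ℕ) (t : Bdry m n → J) (u : A) :
    Rw (bipM (addCol M fun a => if a = u then 2 else 0) fun b => .inl (t b)) (bipM M t) := by
  refine Rw.trans ?_ ((bip_rw_bipM _ _).symm.trans
    (loop_x_edges (E := Σ p : A × J, Fin (M p.1 p.2)) Sigma.fst t u))
  refine bipM_of_eq ?_ _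
  intro a j
  simp only [card_fiber_sum, Sum.elim_inl, Sum.elim_inr]
  rcases j with j | j <;>
    simp only [Prod.mk.injEq, Sum.inl.injEq, reduceCtorEq, and_true, and_false,
      card_subtype_false, not_false_eq_true, implies_true, zero_add, add_zero, addCol,
      Sum.elim_inl, Sum.elim_inr, card_fiber_const, Nat.card_fin]
  exact (card_fiber_sigma (fun p : A × J => M p.1 p.2) (a, j)).symm.trans
    (Nat.card_congr (Equiv.subtypeEquivRight fun e => Prod.ext_iff))

theorem bipM_loop_z [DecidableEq J] (M : A → J → ℕ) (t : Bdry m n → J) (i : J) :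
    Rw (bipM (addRow M fun j => if j = i then 2 else 0) t) (bipM M t) := by
  refine Rw.trans ?_ ((bip_rw_bipM _ _).symm.trans
    (loop_z_edges (E := Σ p : A × J, Fin (M p.1 p.2)) Sigma.fst t i))
  refine bipM_of_eq ?_ _
  intro a j
  simp only [card_fiber_sum, Sum.elim_inl, Sum.elim_inr]
  rcases a with a | a <;>
    simp only [Prod.mk.injEq, Sum.inl.injEq, reduceCtorEq, true_and, false_and,
      card_subtype_false, not_false_eq_true, implies_true, zero_add, add_zero, addRow,
      Sum.elim_inl, Sum.elim_inr, card_fiber_const, Nat.card_fin]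
  exact (card_fiber_sigma (fun p : A × J => M p.1 p.2) (a, j)).symm.trans
    (Nat.card_congr (Equiv.subtypeEquivRight fun e => Prod.ext_iff))

/-! ## Row operations -/

/-- An X spider joined to all rows according to `s` and to two further rows can be eliminated
through either of the two. -/
theorem bipM_elim_elim (M : A → J → ℕ) (s : A → ℕ) (r r' : J → ℕ) (t : Bdry m n → J) :
    Rw (bipM (addRow (fun a j => M a j + s a * r j) fun j => r' j + r j) t)
      (bipM (addRow (fun a j => M a j + s a * r' j) fun j => r j + r' j) t) := by
  -- The common source has rows `M`, `r`, `r'` and a further column equal to `s` on `M` and to `1`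
  -- on both `r` and `r'`. The entries `1` allow either row to serve as pivot.
  refine Rw.trans ?_ ((bipM_elim (addRow M r') (Sum.elim s fun _ => 1) r t).symm.trans
    (.trans ?_ ((bipM_elim (addRow M r) (Sum.elim s fun _ => 1) r' t).trans ?_)))
  · refine bipM_of_eq ?_ _
    rintro (a | a) j <;> simp [addRow]
  · refine bipM_congr (sumRightSwap _ _ _) (.refl _) ?_ fun _ => rfl
    rintro ((a | a) | a) (j | j) <;> rfl
  · refine bipM_of_eq ?_ _
    rintro (a | a) j <;> simp [addRow]

/-- Multiples of one row may be added to the other rows. -/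
theorem bipM_row_add (M : A → J → ℕ) (s : A → ℕ) (r : J → ℕ) (t : Bdry m n → J) :
    Rw (bipM (addRow M r) t) (bipM (addRow (fun a j => M a j + s a * r j) r) t) := by
  -- With one of the two rows zero, one elimination leaves `M` unchanged and the other adds `s`
  -- times `r`; the extra row is `r` both times.
  refine Rw.trans ?_ ((bipM_elim_elim M s 0 r t).trans ?_)
  · refine bipM_of_eq ?_ _
    rintro (a | a) j <;> simp [addRow]
  · refine bipM_of_eq ?_ _
    rintro (a | a) j <;> simp [addRow]

/-! ## Parallel edges -/

/-- A temporary X spider, attached only to a temporary row `r`, contributes nothing when eliminated.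
If that row is first added `s`-fold to `M`, then `M` gains `s rᵀ`, and the elimination adds `s rᵀ` a
second time. With `s` and `r` unit vectors this is the Hopf law. -/
theorem bipM_hopf (M : A → J → ℕ) (s : A → ℕ) (r : J → ℕ) (t : Bdry m n → J) :
    Rw (bipM M t) (bipM (fun a j => M a j + 2 * (s a * r j)) t) := by
  refine Rw.trans ?_ ((bipM_elim M 0 r t).symm.trans
    (.trans (bipM_row_add (addCol M 0) s (Sum.elim r fun _ => 1) _) (.trans ?_
      ((bipM_elim (fun a j => M a j + s a * r j) s r t).trans ?_))))
  · exact bipM_of_eq (by simp) _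
  · refine bipM_of_eq ?_ _
    rintro (a | a) (j | j) <;> simp [addRow, addCol, block]
  · exact bipM_of_eq (fun _ _ => by ring) _

theorem bipM_add_two_mul (M N : A → J → ℕ) (t : Bdry m n → J) :
    Rw (bipM M t) (bipM (fun a j => M a j + 2 * N a j) t) := by
  classical
  have := Fintype.ofFinite A
  suffices H : ∀ S : Finset A, Rw (bipM M t)
      (bipM (fun a j => M a j + if a ∈ S then 2 * N a j else 0) t) by
    simpa using H Finset.univ
  intro S
  induction S using Finset.induction_on with
  | empty => exact bipM_of_eq (by simp) _
  | insert u S hu ih =>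
    refine ih.trans ((bipM_hopf _ (Pi.single u 1) (N u) t).trans (bipM_of_eq ?_ _))
    intro a j
    by_cases h : a = u
    · subst h; simp [hu]
    · simp [h]

/-- From here on matrices count only over 𝔽₂. -/
theorem bipM_of_mod_two {M M' : A → J → ℕ} (h : ∀ a j, M a j % 2 = M' a j % 2)
    (t : Bdry m n → J) : Rw (bipM M t) (bipM M' t) := by
  have H (M : A → J → ℕ) : Rw (bipM (fun a j => M a j % 2) t) (bipM M t) :=
    (bipM_add_two_mul _ (fun a j => M a j / 2) t).trans
      (bipM_of_eq (fun a j => Nat.mod_add_div _ _) _)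
  exact (H M).symm.trans ((bipM_of_eq h t).trans (H M'))

/-! ## Isolated spiders -/

theorem bipM_pair (M : A → J → ℕ) (t : Bdry m n → J) :
    Rw (bipM (block M 0 0) fun b => .inl (t b)) (bipM M t) :=
  (bipM_elim M 0 0 t).trans (bipM_of_eq (by simp) _)

/-- Modulo 2 an isolated X spider is the same as one joined to a Z spider by two edges. That one is
a two-legged spider on a loop, and loops disappear. The isolated pair is introduced so that there is
a Z spider to attach to, even if `A` is empty; `bipM_zero_row` is the same with the colours
exchanged. -/
theorem bipM_zero_col (M : A → J → ℕ) (t : Bdry m n → J) :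
    Rw (bipM (addCol M 0) fun b => .inl (t b)) (bipM M t) := by
  classical
  refine (bipM_pair _ _).symm.trans (.trans ?_
    ((bipM_loop_x (block M 0 0) (fun b => .inl (t b)) (.inr ())).trans (bipM_pair M t)))
  refine Rw.trans (bipM_congr (M' := addCol (block M 0 0) 0) (t' := fun b => .inl (.inl (t b)))
    (.refl _) (sumRightSwap _ _ _) ?_ fun _ => rfl) (bipM_of_mod_two ?_ _)
  · rintro (a | a) ((j | j) | j) <;> rfl
  · intro a j
    rcases j with j | j
    · rfl
    · simp only [addCol, Sum.elim_inr]
      split_ifs <;> simp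

theorem bipM_zero_row (M : A → J → ℕ) (t : Bdry m n → J) :
    Rw (bipM (addRow M 0) t) (bipM M t) := by
  classical
  refine (bipM_pair _ _).symm.trans (.trans ?_
    ((bipM_loop_z (block M 0 0) (fun b => .inl (t b)) (.inr ())).trans (bipM_pair M t)))
  refine Rw.trans (bipM_congr (M' := addRow (block M 0 0) 0) (t' := fun b => .inl (t b))
    (sumRightSwap _ _ _) (.refl _) ?_ fun _ => rfl) (bipM_of_mod_two ?_ _)
  · rintro ((a | a) | a) (j | j) <;> rfl
  · intro a j
    rcases a with a | a
    · rfl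
    · simp only [addRow, Sum.elim_inr]
      split_ifs <;> simp

/-! ## Eliminating all internal X spiders -/

/-- Moves a chosen vertex to the last position, where `addRow` and `block` have their distinguished
row. -/
theorem exists_equiv_sum_unit {A : Type} [Finite A] (u : A) :
    ∃ (B : Type) (_ : Finite B) (e : B ⊕ Unit ≃ A), e (.inr ()) = u := by
  classical
  refine ⟨{a // a ≠ u}, inferInstance,
    ⟨Sum.elim (fun a => a) fun _ => u, fun a => if h : a = u then .inr () else .inl ⟨a, h⟩,
      ?_, ?_⟩, rfl⟩
  · rintro (a | a)
    · simp [a.2]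
    · simp
  · intro a
    by_cases h : a = u <;> simp [h]

/-- If all entries of the column are even, the X spider is isolated modulo 2 and can be dropped.
Otherwise an odd entry may be taken to be `1`, and its row is the pivot for `bipM_elim`. -/
theorem exists_elim_col (M : A → J ⊕ Unit → ℕ) (t : Bdry m n → J) :
    ∃ (B : Type) (_ : Finite B) (N : B → J → ℕ),
      Rw (bipM M fun b => .inl (t b)) (bipM N t) := by
  by_cases h : ∀ a, M a (.inr ()) % 2 = 0
  · refine ⟨A, ‹_›, fun a j => M a (.inl j), .trans (bipM_of_mod_two ?_ _) (bipM_zero_col _ t)⟩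
    rintro a (j | j)
    · rfl
    · exact h a
  · push Not at h
    obtain ⟨u, hu⟩ := h
    obtain ⟨B, _, e, rfl⟩ := exists_equiv_sum_unit u
    refine ⟨B, ‹_›, _, .trans (bipM_congr (M' := fun a => M (e a)) e.symm (.refl _)
      (fun a j => by simp) fun _ => rfl) (.trans (bipM_of_mod_two ?_ _) (bipM_elim
        (fun a j => M (e (.inl a)) (.inl j)) (fun a => M (e (.inl a)) (.inr ()))
        (fun j => M (e (.inr ())) (.inl j)) t))⟩
    rintro (a | a) (j | j)
    · rfl
    · rfl
    · rfl
    · exact Nat.mod_two_ne_zero.1 hu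

theorem exists_elim_cols {I : Type} [Finite I] (M : A → J ⊕ I → ℕ) (t : Bdry m n → J) :
    ∃ (B : Type) (_ : Finite B) (N : B → J → ℕ),
      Rw (bipM M fun b => .inl (t b)) (bipM N t) := by
  -- The set of rows varies in the induction, since a pivot removes its row along with the column.
  suffices H : ∀ (A : Type) [Finite A] (M : A → J ⊕ I → ℕ), ∃ (B : Type) (_ : Finite B)
      (N : B → J → ℕ), Rw (bipM M fun b => .inl (t b)) (bipM N t) from H A M
  clear M
  refine Finite.induction_empty_option (P := fun I => ∀ [Finite I] (A : Type) [Finite A]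
    (M : A → J ⊕ I → ℕ), ∃ (B : Type) (_ : Finite B)
      (N : B → J → ℕ), Rw (bipM M fun b => .inl (t b)) (bipM N t)) ?_ ?_ ?_ I
  · intro I I' e ih _ A _ M
    have := Finite.of_equiv I' e.symm
    obtain ⟨B, _, N, h⟩ := ih A fun a j => M a (Sum.map id e j)
    refine ⟨B, _, N, .trans (bipM_congr (.refl _) (.sumCongr (.refl _) e.symm) ?_
      fun _ => rfl) h⟩
    rintro a (j | j) <;> simp
  · intro _ A _ M
    refine ⟨A, ‹_›, fun a j => M a (.inl j), bipM_congr (.refl _) (.sumEmpty _ _) ?_ fun _ => rfl⟩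
    rintro a (j | j)
    · rfl
    · exact j.elim
  · intro I _ ih _ A _ M
    obtain ⟨A', _, M', h'⟩ := exists_elim_col (J := J ⊕ I)
      (fun a => Sum.elim (fun j => M a (Sum.map id some j)) fun _ => M a (.inr none))
      fun b => .inl (t b)
    obtain ⟨B, _, N, h⟩ := ih A' M'
    refine ⟨B, _, N, .trans (bipM_congr (.refl _)
      ⟨Sum.elim (fun j => .inl (.inl j)) fun o => o.elim (.inr ()) fun i => .inl (.inr i),
        Sum.elim (Sum.map id some) fun _ => .inr none, ?_, ?_⟩ ?_ fun _ => rfl) (h'.trans h)⟩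
    · rintro (_ | _ | _) <;> rfl
    · rintro ((_ | _) | _) <;> rfl
    · rintro a (_ | _ | _) <;> rfl

/-! ## Matrices with the same row space -/

/-- A row in the span of the other rows can be added. -/
theorem bipM_add_span_row [Fintype A] (M : A → J → ℕ) (z : A → ℕ) (r : J → ℕ)
    (h : ∀ j, r j % 2 = (∑ a, z a * M a j) % 2) (t : Bdry m n → J) :
    Rw (bipM M t) (bipM (addRow M r) t) := by
  classical
  -- The new row starts as a zero row, which is free, and grows by one summand at a time.
  suffices H : ∀ S : Finset A, Rw (bipM M t) (bipM (addRow M fun j => ∑ a ∈ S, z a * M a j) t) by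
    refine (H Finset.univ).trans (bipM_of_mod_two ?_ _)
    rintro (a | a) j
    · rfl
    · exact (h j).symm
  intro S
  induction S using Finset.induction_on with
  | empty => exact (bipM_zero_row M t).symm.trans (bipM_of_eq (by rintro (a | a) j <;> rfl) _)
  | insert u S hu ih =>
    refine ih.trans ?_
    obtain ⟨B, _, e, rfl⟩ := exists_equiv_sum_unit u
    -- Row addition takes multiples of the last row, so row `u` is moved there; the multipliers are
    -- then zero except at the new row.
    have key (v : J → ℕ) : Rw (bipM (addRow M v) t) (bipM (addRow
        (addRow (fun b => M (e (.inl b))) v) (M (e (.inr ())))) t) := by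
      refine bipM_congr ((Equiv.sumCongr e.symm (.refl _)).trans (sumRightSwap _ _ _)) (.refl _)
        ?_ fun _ => rfl
      rintro (a | a) j
      · obtain ⟨a, rfl⟩ := e.surjective a
        rcases a with a | a <;> simp [addRow, sumRightSwap]
      · rfl
    refine (key _).trans ((bipM_row_add _ (Sum.elim (fun _ => 0) fun _ => z (e (.inr ()))) _ _).trans
      (.trans (bipM_of_eq ?_ _) (key _).symm))
    rintro ((a | a) | a) j
    · simp [addRow]
    · simp [addRow, Finset.sum_insert hu, add_comm]
    · rfl

theorem bipM_add_span_rows {B : Type} [Finite B] [Fintype A] (M : A → J → ℕ) (N : B → J → ℕ)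
    (h : ∀ b, ∃ z : A → ℕ, ∀ j, N b j % 2 = (∑ a, z a * M a j) % 2) (t : Bdry m n → J) :
    Rw (bipM M t) (bipM (Sum.elim M N) t) := by
  refine Finite.induction_empty_option (P := fun B => ∀ [Finite B] (N : B → J → ℕ)
    (_ : ∀ b, ∃ z : A → ℕ, ∀ j, N b j % 2 = (∑ a, z a * M a j) % 2),
      Rw (bipM M t) (bipM (Sum.elim M N) t)) ?_ ?_ ?_ B N h
  · intro B B' e ih _ N h
    have := Finite.of_equiv B' e.symm
    refine (ih (N ∘ e) fun b => h _).trans (bipM_congr (.sumCongr (.refl _) e) (.refl _) ?_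
      fun _ => rfl)
    rintro (a | a) j <;> rfl
  · intro _ N _
    refine bipM_congr (Equiv.sumEmpty _ _).symm (.refl _) (fun _ _ => rfl) fun _ => rfl
  · intro B _ ih _ N h
    obtain ⟨z, hz⟩ := h none
    -- The rows adjoined earlier get coefficient `0`.
    refine (ih (N ∘ some) fun b => h _).trans ((bipM_add_span_row _ (Sum.elim z 0) (N none)
      (fun j => by simpa using hz j) t).trans (bipM_congr
        ⟨Sum.elim (Sum.map id some) fun _ => .inr none,
          Sum.elim (fun j => .inl (.inl j)) fun o => o.elim (.inr ()) fun i => .inl (.inr i), ?_, ?_⟩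
        (.refl _) ?_ fun _ => rfl))
    · rintro ((_ | _) | _) <;> rfl
    · rintro (_ | _ | _) <;> rfl
    · rintro ((_ | _) | _) j <;> rfl

/-- Both matrices can be enlarged by the rows of the other, which are redundant; the two stacked
matrices differ only in the order of their rows. -/
theorem bipM_of_span_eq {B : Type} [Fintype B] [Fintype A] (M : A → J → ℕ) (N : B → J → ℕ)
    (h : ∀ b, ∃ z : A → ℕ, ∀ j, N b j % 2 = (∑ a, z a * M a j) % 2)
    (h' : ∀ a, ∃ z : B → ℕ, ∀ j, M a j % 2 = (∑ b, z b * N b j) % 2) (t : Bdry m n → J) :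
    Rw (bipM M t) (bipM N t) := by
  refine (bipM_add_span_rows M N h t).trans (.trans ?_ (bipM_add_span_rows N M h' t).symm)
  refine bipM_congr (.sumComm _ _) (.refl _) ?_ fun _ => rfl
  rintro (_ | _) j <;> rfl

end MatrixRules

/-! ## Rewriting inside composites -/

section Congruence

variable {m k n m' n' : ℕ}

/-- The other factor together with the gluing points forms the context. -/
def Graph.compIsoCtxLeft (G : Graph m k) (H : Graph k n) :
    haveI := H.finV; haveI := H.finE
    (G.comp H).Iso (G.ctx (V₁ := H.V ⊕ Fin k) (E₁ := H.E) (Sum.elim H.kind fun _ => .wire)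
      (fun e => (H.ends e).map (Sum.elim (fun v => .inl (.inl v))
        (Sum.elim (fun j => .inl (.inr j)) fun i => .inr (.inr i))))
      (Sum.elim (fun i => .inr (.inl i)) fun j => .inl (.inr j))) :=
  haveI := H.finV; haveI := H.finE
  { onV := Equiv.sumAssoc _ _ _
    onE := .refl _
    kind_eq := by rintro ((_ | _) | _) <;> rfl
    ends_eq := by
      rintro (e | e)
      · exact sym2_map_eq_map_map (by rintro (_ | _ | _) <;> rfl) _
      · exact sym2_map_map_congr (by rintro (_ | _ | _) <;> rfl) _ }

def Graph.compIsoCtxRight (G : Graph m k) (H : Graph k n) :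
    haveI := G.finV; haveI := G.finE
    (G.comp H).Iso (H.ctx (V₁ := G.V ⊕ Fin k) (E₁ := G.E) (Sum.elim G.kind fun _ => .wire)
      (fun e => (G.ends e).map (Sum.elim (fun v => .inl (.inl v))
        (Sum.elim (fun i => .inr (.inl i)) fun j => .inl (.inr j))))
      (Sum.elim (fun j => .inl (.inr j)) fun i => .inr (.inr i))) :=
  haveI := G.finV; haveI := G.finE
  { onV := (Equiv.sumCongr (Equiv.sumComm _ _) (.refl _)).trans (Equiv.sumAssoc _ _ _)
    onE := .sumComm _ _
    kind_eq := by rintro ((_ | _) | _) <;> rfl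
    ends_eq := by
      rintro (e | e)
      · exact sym2_map_map_congr (by rintro (_ | _ | _) <;> rfl) _
      · exact sym2_map_eq_map_map (by rintro (_ | _ | _) <;> rfl) _ }

def Graph.tensorIsoCtxLeft (G : Graph m n) (H : Graph m' n') :
    haveI := H.finV; haveI := H.finE
    (G.tensor H).Iso (G.ctx (V₁ := H.V) (E₁ := H.E) H.kind
      (fun e => (H.ends e).map (Sum.map id (Sum.map (Fin.natAdd m) (Fin.natAdd n))))
      (fun b => .inr (Sum.map (Fin.castAdd m') (Fin.castAdd n') b))) :=
  haveI := H.finV; haveI := H.finE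
  { onV := .refl _
    onE := .refl _
    kind_eq := by rintro (_ | _) <;> rfl
    ends_eq := by
      rintro (e | e)
      · exact sym2_map_eq_map_map (by rintro (_ | _ | _) <;> rfl) _
      · exact sym2_map_map_congr (by rintro (_ | _ | _) <;> rfl) _ }

def Graph.tensorIsoCtxRight (G : Graph m n) (H : Graph m' n') :
    haveI := G.finV; haveI := G.finE
    (G.tensor H).Iso (H.ctx (V₁ := G.V) (E₁ := G.E) G.kind
      (fun e => (G.ends e).map (Sum.map id (Sum.map (Fin.castAdd m') (Fin.castAdd n'))))
      (fun b => .inr (Sum.map (Fin.natAdd m) (Fin.natAdd n) b))) :=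
  haveI := G.finV; haveI := G.finE
  { onV := .sumComm _ _
    onE := .sumComm _ _
    kind_eq := by rintro (_ | _) <;> rfl
    ends_eq := by
      rintro (e | e)
      · exact sym2_map_map_congr (by rintro (_ | _ | _) <;> rfl) _
      · exact sym2_map_eq_map_map (by rintro (_ | _ | _) <;> rfl) _ }

theorem Rw.comp {G G' : Graph m k} {H H' : Graph k n} (hG : Rw G G') (hH : Rw H H') :
    Rw (G.comp H) (G'.comp H') := by
  have := H.finV; have := H.finE; have := G'.finV; have := G'.finE
  exact ((Graph.compIsoCtxLeft G H).rw.trans ((hG.ctx _ _ _).trans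
    (Graph.compIsoCtxLeft G' H).rw.symm)).trans ((Graph.compIsoCtxRight G' H).rw.trans
      ((hH.ctx _ _ _).trans (Graph.compIsoCtxRight G' H').rw.symm))

theorem Rw.tensor {G G' : Graph m n} {H H' : Graph m' n'} (hG : Rw G G') (hH : Rw H H') :
    Rw (G.tensor H) (G'.tensor H') := by
  have := H.finV; have := H.finE; have := G'.finV; have := G'.finE
  exact ((Graph.tensorIsoCtxLeft G H).rw.trans ((hG.ctx _ _ _).trans
    (Graph.tensorIsoCtxLeft G' H).rw.symm)).trans ((Graph.tensorIsoCtxRight G' H).rw.trans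
      ((hH.ctx _ _ _).trans (Graph.tensorIsoCtxRight G' H').rw.symm))

end Congruence

/-! ## Diagrams as bipartite graphs -/

/-- The graph can be rewritten into a bipartite graph. -/
def HasBip {m n : ℕ} (G : Graph m n) : Prop :=
  ∃ (A J E : Type) (_ : Finite A) (_ : Finite J) (_ : Finite E) (f : E → A × J)
    (t : Bdry m n → J), Rw G (bip f t)

section HasBip

variable {m k n m' n' : ℕ}

/-- Graphs that consist of wires between the inputs and outputs. -/
theorem hasBip_wires {K : Type} [Finite K] (e : K ⊕ K ≃ Bdry m n) {G : Graph m n}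
    (iso : G.Iso (plainWires (V₀ := Empty) (E₀ := Empty) Empty.elim Empty.elim
      (fun k => .inr (e (.inl k))) fun k => .inr (e (.inr k)))) : HasBip G := by
  -- An X spider placed on each wire takes over both of its ends.
  refine ⟨Empty, K, Empty, inferInstance, ‹_›, inferInstance, Empty.elim,
    fun b => Sum.elim id id (e.symm b), iso.rw.trans ((midVertices_rw (fun _ => .spider .x)
      _ _ _ _).symm.trans (Graph.Iso.rw ⟨.refl _, .sumCongr (.refl _) e, ?_, ?_⟩))⟩
  · rintro (v | _)
    · exact v.elim
    · rfl
  · rintro (v | k | k)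
    · exact v.elim
    · refine Eq.trans ?_ Sym2.eq_swap
      exact congrArg (fun x => s(Sum.inl (Sum.inr (Sum.elim id id x)), Sum.inr (e (.inl k))))
        (e.symm_apply_apply _)
    · exact congrArg (fun x => s(Sum.inl (Sum.inr (Sum.elim id id x)), Sum.inr (e (.inr k))))
        (e.symm_apply_apply _)

/-- An X spider is already of the required form; on each leg of a Z spider an X spider is inserted.
-/
theorem hasBip_spider (c : Color) : HasBip (Diagram.spider c m n).graph := by
  cases c with
  | x =>
    refine ⟨Empty, Unit, Empty, inferInstance, inferInstance, inferInstance, Empty.elim,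
      fun _ => (), Graph.Iso.rw ⟨(Equiv.emptySum _ _).symm, (Equiv.emptySum _ _).symm,
        fun _ => rfl, fun _ => rfl⟩⟩
  | z =>
    have h := midVertices_rw (K := Bdry m n) (V₀ := Unit) (E₀ := Empty) (fun _ => .spider .x)
      (fun _ => .spider .z) Empty.elim (fun _ => .inl ()) fun b => .inr b
    refine ⟨Unit, Bdry m n, Bdry m n, inferInstance, inferInstance, inferInstance,
      fun b => ((), b), id, Rw.trans (Graph.Iso.rw ?_) (h.symm.trans (Graph.Iso.rw ?_))⟩
    · exact ⟨.refl _, (Equiv.emptySum _ _).symm, fun _ => rfl, fun _ => rfl⟩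
    · refine ⟨.refl _, .emptySum _ _, fun v => by rcases v with _ | _ <;> rfl, ?_⟩
      rintro (v | b | b)
      · exact v.elim
      · rfl
      · rfl

theorem HasBip.tensor {G : Graph m n} {H : Graph m' n'} (hG : HasBip G) (hH : HasBip H) :
    HasBip (G.tensor H) := by
  obtain ⟨A, J, E, _, _, _, f, t, hG⟩ := hG
  obtain ⟨A', J', E', _, _, _, f', t', hH⟩ := hH
  let eB : Bdry m n ⊕ Bdry m' n' ≃ Bdry (m + m') (n + n') :=
    (Equiv.sumSumSumComm _ _ _ _).trans (.sumCongr finSumFinEquiv finSumFinEquiv)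
  have hl (b : Bdry m n) : eB (.inl b) = Sum.map (Fin.castAdd m') (Fin.castAdd n') b := by
    rcases b with b | b <;> rfl
  have hr (b : Bdry m' n') : eB (.inr b) = Sum.map (Fin.natAdd m) (Fin.natAdd n) b := by
    rcases b with b | b <;> rfl
  refine ⟨A ⊕ A', J ⊕ J', E ⊕ E', inferInstance, inferInstance, inferInstance,
    Sum.elim (fun e => (.inl (f e).1, .inl (f e).2)) fun e => (.inr (f' e).1, .inr (f' e).2),
    fun b => Sum.map t t' (eB.symm b), (hG.tensor hH).trans (Graph.Iso.rw
      ⟨Equiv.sumSumSumComm _ _ _ _,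
        (Equiv.sumSumSumComm _ _ _ _).trans (.sumCongr (.refl _) eB), ?_, ?_⟩)⟩
  · rintro ((_ | _) | (_ | _)) <;> rfl
  · rintro ((e | b) | (e | b))
    · rfl
    · exact congrArg₂ (fun x y => s(Sum.inl (Sum.inr (Sum.map t t' x)), Sum.inr y))
        (eB.symm_apply_apply _) (hl b)
    · rfl
    · exact congrArg₂ (fun x y => s(Sum.inl (Sum.inr (Sum.map t t' x)), Sum.inr y))
        (eB.symm_apply_apply _) (hr b)

/-- Every gluing point lies between two X spiders. Turned into a Z spider, it keeps the graph
bipartite. -/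
theorem HasBip.comp {G : Graph m k} {H : Graph k n} (hG : HasBip G) (hH : HasBip H) :
    HasBip (G.comp H) := by
  obtain ⟨A, J, E, _, _, _, f, t, hG⟩ := hG
  obtain ⟨A', J', E', _, _, _, f', t', hH⟩ := hH
  let ends₀ : (E ⊕ E') ⊕ Bdry m n → Sym2 (((A ⊕ A') ⊕ (J ⊕ J')) ⊕ Bdry m n) :=
    Sum.elim
      (Sum.elim (fun e => s(.inl (.inl (.inl (f e).1)), .inl (.inr (.inl (f e).2))))
        fun e => s(.inl (.inl (.inr (f' e).1)), .inl (.inr (.inr (f' e).2))))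
      (Sum.elim (fun i => s(.inl (.inr (.inl (t (.inl i)))), .inr (.inl i)))
        fun i => s(.inl (.inr (.inr (t' (.inr i)))), .inr (.inr i)))
  have h (κ : Fin k → Kind) := midVertices_rw (K := Fin k) (V₀ := (A ⊕ A') ⊕ (J ⊕ J'))
    (E₀ := (E ⊕ E') ⊕ Bdry m n) κ
    (Sum.elim (fun _ => .spider .z) fun _ => .spider .x) ends₀
    (fun j => .inl (.inr (.inl (t (.inr j))))) fun j => .inl (.inr (.inr (t' (.inl j))))
  refine ⟨(A ⊕ A') ⊕ Fin k, J ⊕ J', (E ⊕ E') ⊕ (Fin k ⊕ Fin k), inferInstance, inferInstance,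
    inferInstance,
    Sum.elim (Sum.elim (fun e => (.inl (.inl (f e).1), .inl (f e).2))
        fun e => (.inl (.inr (f' e).1), .inr (f' e).2))
      (Sum.elim (fun j => (.inr j, .inl (t (.inr j)))) fun j => (.inr j, .inr (t' (.inl j)))),
    Sum.elim (fun i => .inl (t (.inl i))) fun i => .inr (t' (.inr i)),
    (hG.comp hH).trans (Rw.trans (Graph.Iso.rw ?_) (((h fun _ => .wire).trans
      (h fun _ => .spider .z).symm).trans (Graph.Iso.rw ?_)))⟩
  · refine Graph.Iso.mk (.sumCongr (Equiv.sumSumSumComm _ _ _ _) (.refl _))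
      ⟨Sum.elim
          (Sum.elim (fun e => .inl (.inl (.inl e)))
            (Sum.elim (fun i => .inl (.inr (.inl i))) fun j => .inr (.inl j)))
          (Sum.elim (fun e => .inl (.inl (.inr e)))
            (Sum.elim (fun j => .inr (.inr j)) fun i => .inl (.inr (.inr i)))),
        Sum.elim
          (Sum.elim (Sum.elim (fun e => .inl (.inl e)) fun e => .inr (.inl e))
            (Sum.elim (fun i => .inl (.inr (.inl i))) fun i => .inr (.inr (.inr i))))
          (Sum.elim (fun j => .inl (.inr (.inr j))) fun j => .inr (.inr (.inl j))), ?_, ?_⟩ ?_ ?_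
    · rintro ((_ | (_ | _)) | (_ | (_ | _))) <;> rfl
    · rintro (((_ | _) | (_ | _)) | (_ | _)) <;> rfl
    · rintro (((_ | _) | (_ | _)) | _) <;> rfl
    · rintro ((_ | (_ | _)) | (_ | (_ | _)))
      · rfl
      · rfl
      · rfl
      · rfl
      · exact Sym2.eq_swap
      · rfl
  · refine Graph.Iso.mk (sumRightSwap _ _ _) (sumRightSwap _ _ _) ?_ ?_
    · rintro ((_ | _) | _) <;> rfl
    · rintro (((_ | _) | (_ | _)) | (_ | _))
      · rfl
      · rfl
      · rfl
      · rfl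
      · exact Sym2.eq_swap
      · rfl

theorem Diagram.hasBip (D : Diagram m n) : HasBip D.graph := by
  let unitEquiv : Unit ≃ Empty ⊕ Fin 1 := (Equiv.ofUnique _ _).trans (Equiv.emptySum _ _).symm
  induction D with
  | spider c m n => exact hasBip_spider c
  | empty =>
    refine hasBip_wires (K := Empty) (Equiv.equivOfIsEmpty _ _)
      ⟨.refl _, Equiv.equivOfIsEmpty Empty (Empty ⊕ Empty),
      fun v => v.elim, fun v => v.elim⟩
  | wire =>
    exact hasBip_wires (K := Fin 1) (.refl _) ⟨.refl _, unitEquiv,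
      fun v => v.elim, fun _ => rfl⟩
  | swap =>
    refine hasBip_wires (K := Fin 2) (.sumCongr (.refl _) Fin.revPerm)
      ⟨.refl _, (Equiv.emptySum _ _).symm, fun v => v.elim, fun e => ?_⟩
    change Fin 2 at e
    fin_cases e <;> rfl
  | cup =>
    refine hasBip_wires (K := Fin 1) ((finSumFinEquiv (m := 1) (n := 1)).trans
      (Equiv.emptySum (Fin 0) (Fin 2)).symm) ⟨.refl _, unitEquiv,
      fun v => v.elim, fun _ => rfl⟩
  | cap =>
    refine hasBip_wires (K := Fin 1) ((finSumFinEquiv (m := 1) (n := 1)).trans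
      (Equiv.sumEmpty (Fin 2) (Fin 0)).symm) ⟨.refl _, unitEquiv,
      fun v => v.elim, fun _ => rfl⟩
  | comp D E hD hE => exact hD.comp hE
  | tensor D E hD hE => exact hD.tensor hE

/-- Every diagram can be rewritten into a bipartite graph with one X spider for every input and
output. -/
theorem Diagram.exists_normal_form (D : Diagram m n) :
    ∃ (A : Type) (_ : Finite A) (M : A → Bdry m n → ℕ), Rw D.graph (bipM M id) := by
  obtain ⟨A, J, E, _, _, _, f, t, hD⟩ := D.hasBip
  -- On every leg to the boundary a Z spider and then an X spider are inserted. Each input and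
  -- output now has an X spider of its own, and the old X spiders have become internal and can be
  -- eliminated.
  have h1 := midVertices_rw (K := Bdry m n) (V₀ := A ⊕ J) (E₀ := E) (fun _ => .spider .z)
    (Sum.elim (fun _ => .spider .z) fun _ => .spider .x)
    (fun e => s(.inl (.inl (f e).1), .inl (.inr (f e).2)))
    (fun b => .inl (.inr (t b))) fun b => .inr b
  have h2 := midVertices_rw (K := Bdry m n) (V₀ := (A ⊕ J) ⊕ Bdry m n) (E₀ := E ⊕ Bdry m n)
    (fun _ => .spider .x)
    (Sum.elim (Sum.elim (fun _ => .spider .z) fun _ => .spider .x) fun _ => .spider .z)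
    (Sum.elim (fun e => s(.inl (.inl (.inl (f e).1)), .inl (.inl (.inr (f e).2))))
      fun b => s(.inl (.inl (.inr (t b))), .inl (.inr b)))
    (fun b => .inl (.inr b)) fun b => .inr b
  have h3 : Rw (bip f t) (bip (A := A ⊕ Bdry m n) (J := Bdry m n ⊕ J)
      (E := E ⊕ (Bdry m n ⊕ Bdry m n))
      (Sum.elim (fun e => (.inl (f e).1, .inr (f e).2))
        (Sum.elim (fun b => (.inr b, .inr (t b))) fun b => (.inr b, .inl b))) .inl) := by
    refine Rw.trans (Graph.Iso.rw ?_) (h1.symm.trans (Rw.trans (Graph.Iso.rw ?_)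
      (h2.symm.trans (Graph.Iso.rw ?_))))
    · refine Graph.Iso.mk (.refl _) (.refl _) (fun _ => rfl) ?_
      intro e
      refine Eq.trans ?_ (sym2_map_id_of (by rintro (_ | _) <;> rfl) _).symm
      rcases e with e | e <;> rfl
    · refine Graph.Iso.mk (.refl _) (Equiv.sumAssoc _ _ _).symm (fun _ => rfl) ?_
      intro e
      refine Eq.trans ?_ (sym2_map_id_of (by rintro (_ | _) <;> rfl) _).symm
      rcases e with e | e | e <;> rfl
    · refine Graph.Iso.mk
        ⟨Sum.elim (Sum.elim (Sum.elim (fun a => .inl (.inl a)) fun j => .inr (.inr j))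
            fun b => .inl (.inr b)) fun b => .inr (.inl b),
          Sum.elim (Sum.elim (fun a => .inl (.inl (.inl a))) fun b => .inl (.inr b))
            (Sum.elim .inr fun j => .inl (.inl (.inr j))), ?_, ?_⟩
        ⟨Sum.elim (Sum.elim (fun e => .inl (.inl e)) fun b => .inl (.inr (.inl b)))
            (Sum.elim (fun b => .inl (.inr (.inr b))) .inr),
          Sum.elim (Sum.elim (fun e => .inl (.inl e)) (Sum.elim (fun b => .inl (.inr b))
            fun b => .inr (.inl b))) fun b => .inr (.inr b), ?_, ?_⟩ ?_ ?_
      · rintro (((_ | _) | _) | _) <;> rfl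
      · rintro ((_ | _) | (_ | _)) <;> rfl
      · rintro ((_ | _) | (_ | _)) <;> rfl
      · rintro ((_ | (_ | _)) | _) <;> rfl
      · rintro (((_ | _) | _) | _) <;> rfl
      · rintro ((_ | _) | (_ | _))
        · rfl
        · exact Sym2.eq_swap
        · rfl
        · rfl
  obtain ⟨M, hM⟩ : ∃ M : A ⊕ Bdry m n → Bdry m n ⊕ J → ℕ, Rw D.graph (bipM M .inl) :=
    ⟨_, hD.trans (h3.trans (bip_rw_bipM _ _))⟩
  obtain ⟨B, _, N, hN⟩ := exists_elim_cols M id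
  exact ⟨B, ‹_›, N, hM.trans hN⟩

end HasBip

/-! ## The value of a graph -/

/-- The basis of a vertex: points on wires count as Z spiders. -/
def Kind.vec : Kind → Fin 2 → (Fin 2 → ℂ)
  | .spider c => ket c
  | .wire => ket .z

/-- The vectors at the vertices for the assignment `i`, and the basis vectors at the inputs and
outputs. -/
def val {V : Type} {m n : ℕ} (kind : V → Kind) (i : V → Fin 2) (β : Bdry m n → Fin 2) :
    V ⊕ Bdry m n → (Fin 2 → ℂ) :=
  Sum.elim (fun v => (kind v).vec (i v)) fun b => ket .z (β b)

/-- The bilinear pairing of an unordered pair of vectors. -/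
def pair : Sym2 (Fin 2 → ℂ) → ℂ := Sym2.lift ⟨fun u v => u ⬝ᵥ v, dotProduct_comm⟩

@[simp] theorem pair_mk (u v : Fin 2 → ℂ) : pair s(u, v) = u ⬝ᵥ v := rfl

/-- Sum over all assignments of basis indices to the vertices of the product over all edges of the
pairing of the vectors at its ends. -/
def partition {V E : Type} {m n : ℕ} (kind : V → Kind) (ends : E → Sym2 (V ⊕ Bdry m n))
    (β : Bdry m n → Fin 2) : ℂ :=
  ∑ᶠ i : V → Fin 2, ∏ᶠ e, pair ((ends e).map (val kind i β))

/-- The matrix entries of the linear map denoted by a graph. -/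
def Graph.value {m n : ℕ} (G : Graph m n) (β : Bdry m n → Fin 2) : ℂ := partition G.kind G.ends β

section Value

variable {m n : ℕ} {V₀ E₀ : Type}

theorem partition_eq {V E : Type} [Fintype V] [DecidableEq V] [Fintype E] (kind : V → Kind)
    (ends : E → Sym2 (V ⊕ Bdry m n)) (β : Bdry m n → Fin 2) :
    partition kind ends β = ∑ i : V → Fin 2, ∏ e, pair ((ends e).map (val kind i β)) := by
  unfold partition
  rw [finsum_eq_sum_of_fintype]
  exact Finset.sum_congr rfl fun i _ => finprod_eq_prod_of_fintype _

theorem sum_sum_arrow {V W : Type} [Fintype V] [DecidableEq V] [Fintype W] [DecidableEq W]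
    (F : (V ⊕ W → Fin 2) → ℂ) : ∑ i, F i = ∑ i, ∑ j, F (Sum.elim i j) := by
  rw [← Fintype.sum_prod_type']
  exact Fintype.sum_equiv (Equiv.sumArrowEquivProdArrow V W (Fin 2)) _ _ fun i =>
    congrArg F (Sum.elim_comp_inl_inr i).symm

theorem sum_unit_arrow (F : (Unit → Fin 2) → ℂ) : ∑ i, F i = ∑ j, F fun _ => j :=
  Fintype.sum_equiv (Equiv.funUnique Unit (Fin 2)) _ _ fun _ => rfl

theorem sum_fin_two_arrow (F : (Fin 2 → Fin 2) → ℂ) : ∑ i, F i = ∑ x, ∑ y, F ![x, y] := by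
  rw [← Fintype.sum_prod_type']
  refine Fintype.sum_equiv (finTwoArrowEquiv (Fin 2)) _ _ fun i => congrArg F ?_
  ext k; fin_cases k <;> rfl

theorem val_inl {W : Type} (kind : V₀ → Kind) (kind' : W → Kind) (i : V₀ → Fin 2) (j : W → Fin 2)
    (β : Bdry m n → Fin 2) (x : V₀ ⊕ Bdry m n) :
    val (Sum.elim kind kind') (Sum.elim i j) β (Sum.map .inl id x) = val kind i β x := by
  rcases x with x | x <;> rfl

theorem pair_map_inl {W : Type} (kind : V₀ → Kind) (kind' : W → Kind) (i : V₀ → Fin 2)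
    (j : W → Fin 2) (β : Bdry m n → Fin 2) (s : Sym2 (V₀ ⊕ Bdry m n)) :
    pair ((s.map (Sum.map .inl id)).map (val (Sum.elim kind kind') (Sum.elim i j) β)) =
      pair (s.map (val kind i β)) := by
  rw [Sym2.map_map]
  exact congrArg pair (sym2_map_congr (val_inl kind kind' i j β) s)

/-! ## Single-qubit vectors -/

theorem sqrt_two_mul_self : (Real.sqrt 2 : ℂ) * Real.sqrt 2 = 2 := by
  rw [← Complex.ofReal_mul, Real.mul_self_sqrt (by norm_num)]; norm_num

theorem sqrt_two_ne_zero : (Real.sqrt 2 : ℂ) ≠ 0 := by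
  rw [Complex.ofReal_ne_zero]; positivity

theorem ket_orthonormal (c : Color) (i j : Fin 2) :
    ket c i ⬝ᵥ ket c j = if i = j then 1 else 0 := by
  have h := sqrt_two_mul_self
  have h0 := sqrt_two_ne_zero
  cases c <;> fin_cases i <;> fin_cases j <;> simp [ket, dotProduct, Fin.sum_univ_two] <;>
    field_simp <;> first | ring1 | linear_combination -h

/-- Resolution of the identity in a real orthonormal basis; it is the soundness of removing vertices
of degree two. -/
theorem vec_resolution (k : Kind) (u v : Fin 2 → ℂ) :
    ∑ i, (u ⬝ᵥ k.vec i) * (k.vec i ⬝ᵥ v) = u ⬝ᵥ v := by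
  have h := sqrt_two_mul_self
  have h0 := sqrt_two_ne_zero
  have hz : ∑ i, (u ⬝ᵥ ket .z i) * (ket .z i ⬝ᵥ v) = u ⬝ᵥ v := by
    simp [ket, dotProduct, Fin.sum_univ_two]
  rcases k with (_ | _) | _
  · exact hz
  · simp only [Kind.vec, ket, dotProduct, Fin.sum_univ_two, Matrix.cons_val_zero,
      Matrix.cons_val_one]
    field_simp
    linear_combination (-(u 0 * v 0) - u 1 * v 1) * h
  · exact hz

/-- The character of `ℤ/2`. -/
def sgn (x s : Fin 2) : ℂ := if x = 1 ∧ s = 1 then -1 else 1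

theorem sgn_add (x s s' : Fin 2) : sgn x (s + s') = sgn x s * sgn x s' := by
  fin_cases x <;> fin_cases s <;> fin_cases s' <;> simp [sgn]

theorem sgn_sum {K : Type} [Fintype K] (x : Fin 2) (s : K → Fin 2) :
    sgn x (∑ k, s k) = ∏ k, sgn x (s k) := by
  classical
  induction (Finset.univ : Finset K) using Finset.induction_on with
  | empty => simp [sgn]
  | insert k S hk ih => rw [Finset.sum_insert hk, Finset.prod_insert hk, sgn_add, ih]

theorem ket_z_dot_ket_x (i j : Fin 2) :
    ket .z i ⬝ᵥ ket .x j = (Real.sqrt 2 : ℂ)⁻¹ * sgn j i := by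
  fin_cases i <;> fin_cases j <;> simp [ket, dotProduct, Fin.sum_univ_two, sgn, neg_div]

theorem sum_sgn_mul (s s' : Fin 2) : ∑ x, sgn x s * sgn x s' = if s = s' then 2 else 0 := by
  fin_cases s <;> fin_cases s' <;> simp [sgn, Fin.sum_univ_two]
  norm_num

theorem dot_ket_x (u : Fin 2 → ℂ) (x : Fin 2) :
    u ⬝ᵥ ket .x x = (Real.sqrt 2 : ℂ)⁻¹ * ∑ z, sgn x z * (u ⬝ᵥ ket .z z) := by
  rw [← vec_resolution (.spider .z), Finset.mul_sum]
  refine Finset.sum_congr rfl fun z _ => ?_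
  simp only [Kind.vec, ket_z_dot_ket_x]; ring

theorem sum_sgn_ket_x (s : Fin 2) (w : Fin 2 → ℂ) :
    ∑ x, sgn x s * (ket .x x ⬝ᵥ w) = Real.sqrt 2 * (ket .z s ⬝ᵥ w) := by
  rw [← vec_resolution (.spider .x) (ket .z s), Finset.mul_sum]
  refine Finset.sum_congr rfl fun x _ => ?_
  simp only [Kind.vec, ket_z_dot_ket_x]
  rw [← mul_assoc, ← mul_assoc, mul_inv_cancel₀ sqrt_two_ne_zero, one_mul]

/-! ## Soundness of the rules -/

theorem value_midVertex [Finite V₀] [Finite E₀] (k : Kind) (kind₀ : V₀ → Kind)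
    (ends₀ : E₀ → Sym2 (V₀ ⊕ Bdry m n)) (a b : V₀ ⊕ Bdry m n) (β : Bdry m n → Fin 2) :
    (midVertex k kind₀ ends₀ a b).value β = (plainWire kind₀ ends₀ a b).value β := by
  classical
  have := Fintype.ofFinite V₀
  have := Fintype.ofFinite E₀
  refine (partition_eq (V := V₀ ⊕ Unit) (E := E₀ ⊕ Fin 2) _ _ β).trans
    (Eq.trans ?_ (partition_eq (V := V₀) (E := E₀ ⊕ Unit) _ _ β).symm)
  rw [sum_sum_arrow]
  refine Finset.sum_congr rfl fun i _ => ?_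
  rw [sum_unit_arrow]
  simp only [midVertex, plainWire, Fintype.prod_sum_type, Sum.elim_inl, Sum.elim_inr,
    pair_map_inl, Fin.prod_univ_two, Matrix.cons_val_zero, Matrix.cons_val_one, Sym2.map_mk,
    val_inl, pair_mk, Finset.univ_unique, Finset.prod_singleton]
  rw [← Finset.mul_sum]
  exact congrArg _ (vec_resolution k _ _)

/-- By orthonormality each connecting edge is a Kronecker delta of the two indices. There are `p + 1
≥ 1` of them and their product is the same delta, so the two indices are identified. -/
theorem value_fuse [Finite V₀] [Finite E₀] (c : Color) (p : ℕ) (kind₀ : V₀ → Kind)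
    (ends₀ : E₀ → Sym2 ((V₀ ⊕ Fin 2) ⊕ Bdry m n)) (β : Bdry m n → Fin 2) :
    (fuseLHS c p kind₀ ends₀).value β = (fuseRHS c kind₀ ends₀).value β := by
  classical
  have := Fintype.ofFinite V₀
  have := Fintype.ofFinite E₀
  refine (partition_eq (V := V₀ ⊕ Fin 2) (E := E₀ ⊕ Fin (p + 1)) _ _ β).trans
    (Eq.trans ?_ (partition_eq (V := V₀ ⊕ Unit) (E := E₀) _ _ β).symm)
  rw [sum_sum_arrow, sum_sum_arrow]
  refine Finset.sum_congr rfl fun i _ => ?_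
  rw [sum_unit_arrow, sum_fin_two_arrow]
  refine Finset.sum_congr rfl fun x _ => ?_
  have key (y : Fin 2) : val (fuseLHS c p kind₀ ends₀).kind (Sum.elim i ![x, y]) β
      (Sum.inl (Sum.inr 0)) ⬝ᵥ val (fuseLHS c p kind₀ ends₀).kind (Sum.elim i ![x, y]) β
      (Sum.inl (Sum.inr 1)) = if x = y then 1 else 0 := ket_orthonormal c x y
  have h (y : Fin 2) : (∏ e : E₀ ⊕ Fin (p + 1), pair (((fuseLHS c p kind₀ ends₀).ends e).map
      (val (fuseLHS c p kind₀ ends₀).kind (Sum.elim i ![x, y]) β))) = if x = y then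
      ∏ e : E₀, pair ((ends₀ e).map
        (val (fuseLHS c p kind₀ ends₀).kind (Sum.elim i ![x, y]) β)) else 0 := by
    rw [Fintype.prod_sum_type]
    simp only [fuseLHS, Sum.elim_inl, Sum.elim_inr, Sym2.map_mk, pair_mk] at key ⊢
    rw [key]
    split_ifs <;> simp
  refine (Finset.sum_congr rfl fun y _ => h y).trans ?_
  rw [Finset.sum_ite_eq, if_pos (Finset.mem_univ _)]
  refine Finset.prod_congr rfl fun e _ => congrArg pair ?_
  refine sym2_map_eq_map_map ?_ _
  rintro ((v | v) | v)
  · rfl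
  · fin_cases v <;> rfl
  · rfl

/-- Both sides are multiples of one sum over `z`, in which every leg `w l` receives the parity `∑ k,
z k`. On the left, the legs `u k` are expanded in the Z basis, and orthogonality of characters,
summed over `x`, forces `s` to be that parity. On the right, the edges multiply to characters of the
parity, and each sum over `x l` is a Fourier transform back to the Z basis. -/
theorem sc_identity {P Q : Type} [Fintype P] [Fintype Q] [DecidableEq P] [DecidableEq Q]
    (u : P → Fin 2 → ℂ) (w : Q → Fin 2 → ℂ) :
    ∑ x, ∑ s, (ket .x x ⬝ᵥ ket .z s) * ((∏ k, u k ⬝ᵥ ket .x x) * ∏ l, ket .z s ⬝ᵥ w l) =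
      (Real.sqrt 2 : ℂ) ^ (((Fintype.card P : ℤ) - 1) * ((Fintype.card Q : ℤ) - 1)) *
        ∑ z : P → Fin 2, ∑ x : Q → Fin 2,
          (∏ kl : P × Q, ket .z (z kl.1) ⬝ᵥ ket .x (x kl.2)) *
            ((∏ k, u k ⬝ᵥ ket .z (z k)) * ∏ l, ket .x (x l) ⬝ᵥ w l) := by
  set r : ℂ := ((Real.sqrt 2 : ℝ) : ℂ) with hr
  have h0 : r ≠ 0 := sqrt_two_ne_zero
  have hL : ∑ x, ∑ s, (ket .x x ⬝ᵥ ket .z s) * ((∏ k, u k ⬝ᵥ ket .x x) * ∏ l, ket .z s ⬝ᵥ w l) =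
      r * r⁻¹ ^ Fintype.card P * ∑ z : P → Fin 2,
        (∏ k, u k ⬝ᵥ ket .z (z k)) * ∏ l, ket .z (∑ k, z k) ⬝ᵥ w l := by
    have h1 (x : Fin 2) : ∏ k, u k ⬝ᵥ ket .x x = r⁻¹ ^ Fintype.card P *
        ∑ z : P → Fin 2, sgn x (∑ k, z k) * ∏ k, u k ⬝ᵥ ket .z (z k) := by
      simp only [dot_ket_x, Finset.prod_mul_distrib, Finset.prod_const, Finset.card_univ,
        Finset.prod_univ_sum, Fintype.piFinset_univ, sgn_sum, hr]
    simp only [h1, dotProduct_comm (ket .x _) (ket .z _), ket_z_dot_ket_x, ← hr, Finset.mul_sum,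
      Finset.sum_mul]
    have h2 (s : Fin 2) (z : P → Fin 2) : ∑ x, r⁻¹ * sgn x s * (r⁻¹ ^ Fintype.card P *
        (sgn x (∑ k, z k) * ∏ k, u k ⬝ᵥ ket .z (z k)) * ∏ l, ket .z s ⬝ᵥ w l) =
        if s = ∑ k, z k then r * r⁻¹ ^ Fintype.card P *
          ((∏ k, u k ⬝ᵥ ket .z (z k)) * ∏ l, ket .z s ⬝ᵥ w l) else 0 := by
      have h3 : r⁻¹ * 2 = r := by
        rw [← sqrt_two_mul_self, ← hr, ← mul_assoc, inv_mul_cancel₀ h0, one_mul]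
      calc _ = (∑ x, sgn x s * sgn x (∑ k, z k)) * (r⁻¹ * (r⁻¹ ^ Fintype.card P *
          ((∏ k, u k ⬝ᵥ ket .z (z k)) * ∏ l, ket .z s ⬝ᵥ w l))) := by
            rw [Finset.sum_mul]; exact Finset.sum_congr rfl fun x _ => by ring
        _ = _ := by
            rw [sum_sgn_mul]
            split_ifs
            · linear_combination (r⁻¹ ^ Fintype.card P *
                ((∏ k, u k ⬝ᵥ ket .z (z k)) * ∏ l, ket .z s ⬝ᵥ w l)) * h3
            · simp
    rw [Finset.sum_comm]
    refine (Finset.sum_congr rfl fun s _ => Finset.sum_comm.trans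
      (Finset.sum_congr rfl fun z _ => h2 s z)).trans ?_
    rw [Finset.sum_comm]
    simp only [Finset.sum_ite_eq', Finset.mem_univ, if_true]
  have hR : ∑ z : P → Fin 2, ∑ x : Q → Fin 2,
        (∏ kl : P × Q, ket .z (z kl.1) ⬝ᵥ ket .x (x kl.2)) *
          ((∏ k, u k ⬝ᵥ ket .z (z k)) * ∏ l, ket .x (x l) ⬝ᵥ w l) =
      (r * r⁻¹ ^ Fintype.card P) ^ Fintype.card Q * ∑ z : P → Fin 2,
        (∏ k, u k ⬝ᵥ ket .z (z k)) * ∏ l, ket .z (∑ k, z k) ⬝ᵥ w l := by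
    rw [Finset.mul_sum]
    refine Finset.sum_congr rfl fun z _ => ?_
    have h1 (x : Q → Fin 2) : (∏ kl : P × Q, ket .z (z kl.1) ⬝ᵥ ket .x (x kl.2)) *
          ((∏ k, u k ⬝ᵥ ket .z (z k)) * ∏ l, ket .x (x l) ⬝ᵥ w l) =
        (∏ k, u k ⬝ᵥ ket .z (z k)) * ∏ l, r⁻¹ ^ Fintype.card P *
          (sgn (x l) (∑ k, z k) * (ket .x (x l) ⬝ᵥ w l)) := by
      simp only [Fintype.prod_prod_type_right, ket_z_dot_ket_x, ← hr, Finset.prod_mul_distrib,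
        sgn_sum, Finset.prod_const, Finset.card_univ, Fintype.card_prod]
      ring
    simp only [h1, ← Finset.mul_sum]
    have h2 := Finset.prod_univ_sum (fun _ : Q => (Finset.univ : Finset (Fin 2)))
      fun l x => r⁻¹ ^ Fintype.card P * (sgn x (∑ k, z k) * (ket .x x ⬝ᵥ w l))
    rw [Fintype.piFinset_univ] at h2
    rw [← h2]
    simp only [← Finset.mul_sum, sum_sgn_ket_x, ← hr, Finset.prod_mul_distrib, Finset.prod_const,
      Finset.card_univ]
    ring
  rw [hL, hR, ← mul_assoc]
  congr 1
  -- With `p` and `q` the two cardinalities, the exponents match because `1 - p = (p - 1) * (q - 1)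
  -- + (1 - p) * q`.
  have h4 : r * r⁻¹ ^ Fintype.card P = r ^ (1 - (Fintype.card P : ℤ)) := by
    rw [zpow_sub₀ h0, zpow_one, zpow_natCast, inv_pow, div_eq_mul_inv]
  rw [h4, ← zpow_natCast, ← zpow_mul, ← zpow_add₀ h0]
  congr 1
  ring

theorem value_sc [Finite V₀] [Finite E₀] (p q : ℕ) (kind₀ : V₀ → Kind)
    (ends₀ : E₀ → Sym2 (V₀ ⊕ Bdry m n)) (a : Fin p → V₀ ⊕ Bdry m n) (b : Fin q → V₀ ⊕ Bdry m n)
    (β : Bdry m n → Fin 2) :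
    (scLHS p q kind₀ ends₀ a b).value β =
      (Real.sqrt 2 : ℂ) ^ (((p : ℤ) - 1) * ((q : ℤ) - 1)) *
        (scRHS p q kind₀ ends₀ a b).value β := by
  classical
  have := Fintype.ofFinite V₀
  have := Fintype.ofFinite E₀
  refine (partition_eq (V := V₀ ⊕ Fin 2) (E := (E₀ ⊕ Unit) ⊕ (Fin p ⊕ Fin q)) _ _ β).trans
    (Eq.trans ?_ (congrArg _ (partition_eq (V := V₀ ⊕ (Fin p ⊕ Fin q))
      (E := (E₀ ⊕ Fin p × Fin q) ⊕ (Fin p ⊕ Fin q)) _ _ β).symm))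
  rw [sum_sum_arrow, sum_sum_arrow, Finset.mul_sum]
  refine Finset.sum_congr rfl fun i _ => ?_
  rw [sum_fin_two_arrow, sum_sum_arrow]
  simp only [scLHS, scRHS, Fintype.prod_sum_type, Sum.elim_inl, Sum.elim_inr,
    pair_map_inl, Sym2.map_mk, val_inl, pair_mk, Finset.univ_unique,
    Finset.prod_singleton, mul_assoc]
  simp only [← Finset.mul_sum]
  rw [mul_left_comm]
  congr 1
  have h := sc_identity (fun k => val kind₀ i β (a k)) fun l => val kind₀ i β (b l)
  rw [Fintype.card_fin, Fintype.card_fin] at h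
  exact h

theorem value_iso {G H : Graph m n} (f : G.Iso H) (β : Bdry m n → Fin 2) :
    G.value β = H.value β := by
  unfold Graph.value partition
  rw [← finsum_comp_equiv (f.onV.arrowCongr (.refl (Fin 2)))]
  refine finsum_congr fun i => ?_
  rw [← finprod_comp_equiv f.onE]
  refine finprod_congr fun e => congrArg pair ?_
  rw [f.ends_eq]
  refine sym2_map_eq_map_map ?_ _
  rintro (v | v)
  · simp [val, f.kind_eq]
  · rfl

/-- The factor being nonzero is part of the claim, because `symm` inverts it. -/
theorem Derives.sound {c : ℂ} {G H : Graph m n} (h : Derives c G H) :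
    c ≠ 0 ∧ ∀ β, G.value β = c * H.value β := by
  induction h with
  | symm _ ih =>
    refine ⟨inv_ne_zero ih.1, fun β => ?_⟩
    rw [ih.2, inv_mul_cancel_left₀ ih.1]
  | trans _ _ ih ih' =>
    exact ⟨mul_ne_zero ih.1 ih'.1, fun β => by rw [ih.2, ih'.2, mul_assoc]⟩
  | iso f => exact ⟨one_ne_zero, fun β => by rw [one_mul, value_iso f]⟩
  | point kind₀ ends₀ a b => exact ⟨one_ne_zero, fun β => by rw [one_mul, value_midVertex]⟩
  | ident c kind₀ ends₀ a b => exact ⟨one_ne_zero, fun β => by rw [one_mul, value_midVertex]⟩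
  | fuse c p kind₀ ends₀ => exact ⟨one_ne_zero, fun β => by rw [one_mul, value_fuse]⟩
  | sc p q kind₀ ends₀ a b => exact ⟨zpow_ne_zero _ sqrt_two_ne_zero, value_sc p q kind₀ ends₀ a b⟩

end Value

section Denotation

variable {m k n m' n' : ℕ}

/-! ## The value of the graph of a diagram -/

theorem ket_z_dot (i : Fin 2) (u : Fin 2 → ℂ) : ket .z i ⬝ᵥ u = u i := by
  fin_cases i <;> simp [ket, dotProduct, Fin.sum_univ_two]

theorem dot_ket_z (i : Fin 2) (u : Fin 2 → ℂ) : u ⬝ᵥ ket .z i = u i := by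
  rw [dotProduct_comm, ket_z_dot]

/-- The kets are real, so the bilinear pairing of `partition` agrees with the conjugated factors in
`spiderMap`. -/
theorem star_ket (c : Color) (i j : Fin 2) : star (ket c i j) = ket c i j := by
  cases c <;> fin_cases i <;> fin_cases j <;> simp [ket]

theorem value_spider (c : Color) (x : Fin m → Fin 2) (y : Fin n → Fin 2) :
    (Diagram.spider c m n).graph.value (Sum.elim x y) = spiderMap c m n y x := by
  refine (partition_eq (V := Unit) (E := Bdry m n) _ _ _).trans ?_
  rw [sum_unit_arrow]
  refine Finset.sum_congr rfl fun i _ => ?_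
  rw [Fintype.prod_sum_type, mul_comm]
  refine congrArg₂ (· * ·) (Finset.prod_congr rfl fun j _ => ?_)
    (Finset.prod_congr rfl fun j _ => ?_)
  · exact dot_ket_z _ _
  · exact (dot_ket_z _ _).trans (star_ket _ _ _).symm

/-- A gluing point carries a Z basis vector, exactly as a boundary point does, so the sum over its
index is the sum in the matrix product. -/
theorem value_comp (G : Graph m k) (H : Graph k n) (x : Fin m → Fin 2) (y : Fin n → Fin 2) :
    (G.comp H).value (Sum.elim x y) =
      ∑ w : Fin k → Fin 2, H.value (Sum.elim w y) * G.value (Sum.elim x w) := by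
  classical
  have := G.finV; have := G.finE; have := H.finV; have := H.finE
  have := Fintype.ofFinite G.V; have := Fintype.ofFinite G.E
  have := Fintype.ofFinite H.V; have := Fintype.ofFinite H.E
  refine (partition_eq (V := (G.V ⊕ H.V) ⊕ Fin k) (E := G.E ⊕ H.E) _ _ _).trans ?_
  rw [sum_sum_arrow, Finset.sum_comm]
  refine Finset.sum_congr rfl fun w _ => ?_
  rw [sum_sum_arrow, mul_comm]
  refine Eq.trans ?_ (congrArg₂ (· * ·) (partition_eq (V := G.V) (E := G.E) _ _ _).symm
    (partition_eq (V := H.V) (E := H.E) _ _ _).symm)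
  rw [Finset.sum_mul_sum]
  refine Finset.sum_congr rfl fun i _ => Finset.sum_congr rfl fun j _ => ?_
  rw [Fintype.prod_sum_type]
  refine congrArg₂ (· * ·) (Finset.prod_congr rfl fun e _ => congrArg pair ?_)
    (Finset.prod_congr rfl fun e _ => congrArg pair ?_)
  · exact (sym2_map_eq_map_map (by rintro (_ | _ | _) <;> rfl) _).symm
  · exact (sym2_map_eq_map_map (by rintro (_ | _ | _) <;> rfl) _).symm

theorem value_tensor (G : Graph m n) (H : Graph m' n') (β : Bdry (m + m') (n + n') → Fin 2) :
    (G.tensor H).value β =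
      G.value (fun b => β (Sum.map (Fin.castAdd m') (Fin.castAdd n') b)) *
        H.value (fun b => β (Sum.map (Fin.natAdd m) (Fin.natAdd n) b)) := by
  classical
  have := G.finV; have := G.finE; have := H.finV; have := H.finE
  have := Fintype.ofFinite G.V; have := Fintype.ofFinite G.E
  have := Fintype.ofFinite H.V; have := Fintype.ofFinite H.E
  refine (partition_eq (V := G.V ⊕ H.V) (E := G.E ⊕ H.E) _ _ _).trans ?_
  rw [sum_sum_arrow]
  refine Eq.trans ?_ (congrArg₂ (· * ·) (partition_eq (V := G.V) (E := G.E) _ _ _).symm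
    (partition_eq (V := H.V) (E := H.E) _ _ _).symm)
  rw [Finset.sum_mul_sum]
  refine Finset.sum_congr rfl fun i _ => Finset.sum_congr rfl fun j _ => ?_
  rw [Fintype.prod_sum_type]
  refine congrArg₂ (· * ·) (Finset.prod_congr rfl fun e _ => congrArg pair ?_)
    (Finset.prod_congr rfl fun e _ => congrArg pair ?_)
  · exact (sym2_map_eq_map_map (by rintro (_ | _ | _) <;> rfl) _).symm
  · exact (sym2_map_eq_map_map (by rintro (_ | _ | _) <;> rfl) _).symm

theorem Diagram.value_graph (D : Diagram m n) (x : Fin m → Fin 2) (y : Fin n → Fin 2) :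
    D.graph.value (Sum.elim x y) = D.denote y x := by
  induction D with
  | spider c m n => exact value_spider c x y
  | empty =>
    refine (partition_eq (V := Empty) (E := Empty) _ _ _).trans ?_
    rw [Subsingleton.elim y x]
    simp [denote]
  | wire =>
    refine (partition_eq (V := Empty) (E := Unit) _ _ _).trans ?_
    simp only [Finset.univ_unique, Finset.sum_singleton, Finset.prod_singleton]
    refine (ket_orthonormal .z (x 0) (y 0)).trans ?_
    simp only [denote, Matrix.one_apply, funext_iff, Fin.forall_fin_one, eq_comm]
  | swap =>
    refine (partition_eq (V := Empty) (E := Fin 2) _ _ _).trans ?_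
    simp only [Finset.univ_unique, Finset.sum_singleton, Fin.prod_univ_two]
    refine (congrArg₂ (· * ·) (ket_orthonormal .z (x 0) (y 1))
      (ket_orthonormal .z (x 1) (y 0))).trans ?_
    simp only [denote, ← ite_and, mul_ite, mul_one, mul_zero, eq_comm]
  | cup =>
    refine (partition_eq (V := Empty) (E := Unit) _ _ _).trans ?_
    simp only [Finset.univ_unique, Finset.sum_singleton, Finset.prod_singleton]
    exact ket_orthonormal .z (y 0) (y 1)
  | cap =>
    refine (partition_eq (V := Empty) (E := Unit) _ _ _).trans ?_
    simp only [Finset.univ_unique, Finset.sum_singleton, Finset.prod_singleton]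
    exact ket_orthonormal .z (x 0) (x 1)
  | comp D E hD hE =>
    refine (value_comp _ _ x y).trans ?_
    simp only [hD, hE, denote, Matrix.mul_apply]
  | tensor D E hD hE =>
    refine (value_tensor _ _ _).trans ?_
    refine congrArg₂ (· * ·) (Eq.trans (congrArg _ ?_) (hD _ _))
      (Eq.trans (congrArg _ ?_) (hE _ _)) <;> ext (_ | _) <;> rfl

/-! ## The value of a normal form -/

theorem sgn_nsmul (x s : Fin 2) (N : ℕ) : sgn x (N • s) = sgn x s ^ N := by
  simpa using sgn_sum x fun _ : Fin N => s

theorem sum_sgn (s : Fin 2) : ∑ x, sgn x s = if s = 0 then 2 else 0 := by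
  simpa [sgn] using sum_sgn_mul s 0

theorem val_nsmul (N z : ℕ) : ((N • Fin.ofNat 2 z : Fin 2) : ℕ) = z * N % 2 := by
  induction N with
  | zero => rfl
  | succ N ih =>
    rw [succ_nsmul, Fin.val_add, ih, mul_add, mul_one, Nat.add_mod (z * N) z]
    rfl

theorem val_sum {A : Type} [Fintype A] (w : A → Fin 2) :
    ((∑ a, w a : Fin 2) : ℕ) = (∑ a, (w a : ℕ)) % 2 := by
  classical
  induction (Finset.univ : Finset A) using Finset.induction_on with
  | empty => rfl
  | insert a S ha ih =>
    rw [Finset.sum_insert ha, Finset.sum_insert ha, Fin.val_add, ih, Nat.add_mod_mod]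

theorem add_sum_nsmul_eq_zero_iff {A : Type} [Fintype A] (b : Fin 2) (N z : A → ℕ) :
    b + ∑ a, N a • Fin.ofNat 2 (z a) = 0 ↔ (b : ℕ) % 2 = (∑ a, z a * N a) % 2 := by
  rw [Fin.ext_iff, Fin.val_add, val_sum]
  simp only [val_nsmul, ← Finset.sum_nat_mod, Fin.val_zero]
  omega

/-- The value of a normal form at `β` is proportional to the number of linear combinations of the
rows that are equal to `β`. -/
theorem exists_value_bipM {A : Type} [Fintype A] (M : A → Bdry m n → ℕ) (β : Bdry m n → Fin 2) :
    ∃ C : ℂ, C ≠ 0 ∧ (bipM M id).value β =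
      Nat.card {z : A → Fin 2 // ∀ b, β b + ∑ a, M a b • z a = 0} * C := by
  classical
  set h : ℂ := ((Real.sqrt 2 : ℝ) : ℂ)⁻¹ with hh
  have h0 : h ≠ 0 := inv_ne_zero sqrt_two_ne_zero
  -- The X spider `b` has `∑ a, M a b` edges and one boundary leg, each contributing `1 / √2`; the
  -- factor `2` is the character sum over its index when the parity vanishes.
  refine ⟨∏ b, h ^ (1 + ∑ a, M a b) * 2, Finset.prod_ne_zero_iff.2 fun b _ =>
    mul_ne_zero (pow_ne_zero _ h0) two_ne_zero, ?_⟩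
  refine (partition_eq (V := A ⊕ Bdry m n) (E := (Σ p : A × Bdry m n, Fin (M p.1 p.2)) ⊕ Bdry m n)
    _ _ _).trans ?_
  have h1 (z : A → Fin 2) (x : Bdry m n → Fin 2) :
      ∏ e : (Σ p : A × Bdry m n, Fin (M p.1 p.2)) ⊕ Bdry m n,
          pair (((bipM M id).ends e).map (val (bipM M id).kind (Sum.elim z x) β)) =
        ∏ b, h ^ (1 + ∑ a, M a b) * sgn (x b) (β b + ∑ a, M a b • z a) := by
    refine (Fintype.prod_sum_type _).trans ?_
    change (∏ e : Σ p : A × Bdry m n, Fin (M p.1 p.2),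
      (ket .z (z e.1.1) ⬝ᵥ ket .x (x e.1.2))) * (∏ b, ket .x (x b) ⬝ᵥ ket .z (β b)) = _
    rw [Fintype.prod_sigma, Fintype.prod_prod_type_right, ← Finset.prod_mul_distrib]
    refine Finset.prod_congr rfl fun b _ => ?_
    simp only [Finset.prod_const, Finset.card_univ, Fintype.card_fin,
      dotProduct_comm (ket .x _) (ket .z _), ket_z_dot_ket_x, ← hh, sgn_add, sgn_sum, sgn_nsmul,
      mul_pow, Finset.prod_mul_distrib, Finset.prod_pow_eq_pow_sum, pow_add]
    ring
  have h2 (z : A → Fin 2) : ∑ x : Bdry m n → Fin 2,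
      ∏ b, h ^ (1 + ∑ a, M a b) * sgn (x b) (β b + ∑ a, M a b • z a) =
        if ∀ b, β b + ∑ a, M a b • z a = 0 then ∏ b, h ^ (1 + ∑ a, M a b) * 2 else 0 := by
    have h3 := Finset.prod_univ_sum (fun _ : Bdry m n => (Finset.univ : Finset (Fin 2)))
      fun b x => h ^ (1 + ∑ a, M a b) * sgn x (β b + ∑ a, M a b • z a)
    rw [Fintype.piFinset_univ] at h3
    rw [← h3]
    simp only [← Finset.mul_sum, sum_sgn]
    split_ifs with hz
    · exact Finset.prod_congr rfl fun b _ => by rw [if_pos (hz b)]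
    · push Not at hz
      obtain ⟨b, hb⟩ := hz
      exact Finset.prod_eq_zero (Finset.mem_univ b) (by rw [if_neg hb, mul_zero])
  rw [sum_sum_arrow]
  refine (Finset.sum_congr rfl fun z _ => (Finset.sum_congr rfl fun x _ => h1 z x).trans
    (h2 z)).trans ?_
  rw [← Finset.sum_filter, Finset.sum_const, nsmul_eq_mul, Nat.card_eq_fintype_card,
    Fintype.card_subtype]

theorem value_bipM_ne_zero_iff {A : Type} [Fintype A] (M : A → Bdry m n → ℕ)
    (β : Bdry m n → Fin 2) : (bipM M id).value β ≠ 0 ↔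
      ∃ z : A → ℕ, ∀ b, (β b : ℕ) % 2 = (∑ a, z a * M a b) % 2 := by
  obtain ⟨C, hC, h⟩ := exists_value_bipM M β
  rw [h, mul_ne_zero_iff_right hC, Nat.cast_ne_zero, Nat.card_ne_zero]
  simp only [← add_sum_nsmul_eq_zero_iff]
  constructor
  · rintro ⟨⟨z, hz⟩, _⟩
    exact ⟨fun a => z a, fun b => by simpa using hz b⟩
  · rintro ⟨z, hz⟩
    exact ⟨⟨fun a => Fin.ofNat 2 (z a), hz⟩, inferInstance⟩

end Denotation

/-! ## Completeness -/

theorem derives_of_denote_eq_smul {m n : ℕ} (D D' : Diagram m n) (c : ℂ) (hc : c ≠ 0)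
    (h : D.denote = c • D'.denote) : Derives c D.graph D'.graph := by
  have hv (β : Bdry m n → Fin 2) : D.graph.value β = c * D'.graph.value β := by
    rw [← Sum.elim_comp_inl_inr β, Diagram.value_graph, Diagram.value_graph, h]
    rfl
  obtain ⟨A, _, M, hM⟩ := D.exists_normal_form
  obtain ⟨A', _, M', hM'⟩ := D'.exists_normal_form
  have := Fintype.ofFinite A
  have := Fintype.ofFinite A'
  -- All factors are nonzero, so the two normal forms have the same support.
  have hne : ∀ β, (bipM M id).value β ≠ 0 ↔ (bipM M' id).value β ≠ 0 := by
    intro β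
    obtain ⟨d, hd⟩ := hM
    obtain ⟨d', hd'⟩ := hM'
    have h1 := hv β
    rw [hd.sound.2, hd'.sound.2] at h1
    rw [← mul_ne_zero_iff_left hd.sound.1, h1, mul_ne_zero_iff_left hc,
      mul_ne_zero_iff_left hd'.sound.1]
  have rows {B B' : Type} [Fintype B] [Fintype B'] (N : B → Bdry m n → ℕ) (N' : B' → Bdry m n → ℕ)
      (hN : ∀ β, (bipM N id).value β ≠ 0 → (bipM N' id).value β ≠ 0) (b : B) :
      ∃ z : B' → ℕ, ∀ j, N b j % 2 = (∑ a, z a * N' a j) % 2 := by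
    classical
    -- Row `b` of `N`, read as a boundary assignment, lies in the support of `N` with the unit
    -- vector at `b` as coefficients, hence in the support of `N'`.
    obtain ⟨z, hz⟩ := (value_bipM_ne_zero_iff N' fun j => Fin.ofNat 2 (N b j)).1
      (hN _ ((value_bipM_ne_zero_iff N _).2
        ⟨Pi.single b 1, fun j => by simp [Pi.single_apply]⟩))
    exact ⟨z, fun j => by simpa using hz j⟩
  obtain ⟨d, hd⟩ := hM.trans ((bipM_of_span_eq M M' (rows M' M fun β => (hne β).2)
    (rows M M' fun β => (hne β).1) id).trans hM'.symm)
  obtain ⟨d', hd'⟩ := hM'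
  -- The empty combination of rows gives zero, so no phase-free diagram has value zero at `β = 0`.
  have h0 : D'.graph.value 0 ≠ 0 := by
    rw [hd'.sound.2]
    exact mul_ne_zero hd'.sound.1 ((value_bipM_ne_zero_iff M' 0).2 ⟨0, by simp⟩)
  have : d = c := mul_right_cancel₀ h0 ((hd.sound.2 0).symm.trans (hv 0))
  exact this ▸ hd

end

end PhaseFreeZX

/-- If the linear maps of two phase-free ZX diagrams satisfy `⟦D⟧ = c ⟦D'⟧` with `c ≠ 0`
(in particular if they are equal, `c = 1`), then `D` can be rewritten into `c` times `D'`. -/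
theorem mainTheorem2 {m n : ℕ} (D D' : PhaseFreeZX.Diagram m n) (c : ℂ) (hc : c ≠ 0)
    (h : D.denote = c • D'.denote) :
    PhaseFreeZX.Derives c D.graph D'.graph :=
  PhaseFreeZX.derives_of_denote_eq_smul D D' c hc h
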